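/- Let $p,q$ be positive integers, let $\mathcal S_{p+q}$ be the symmetric group on $\{1,\dots,p+q\}$ with identity $\epsilon$, and put $\alpha_{p,q}=(1\,\dots\,p)(p+1\,\dots\,p+q)$. For $\pi\in\mathcal S_{p+q}$ let $\ell(\pi)$ be the smallest $k$ such that $\pi$ is a product of $k$ transpositions, and write $\pi\le\sigma$ if $\ell(\sigma)=\ell(\pi)+\ell(\pi^{-1}\sigma)$. Call $\pi$ connected if some cycle of $\pi$ meets both $\{1,\dots,p\}$ and $\{p+1,\dots,p+q\}$, and disconnected otherwise. Let $\overline{\mathcal S}^{A}_{\mathrm{nc}}(p,q)$ be the set of pairs $(\pi,z)$ with $\pi\in\mathcal S_{p+q}$ and $z\in\{0,1\}$ such that (1) if $\pi$ is disconnected, then $\pi\le\alpha_{p,q}$; (2) if $\pi$ is connected, then $\ell(\alpha_{p,q})=\ell(\pi)+\ell(\pi^{-1}\alpha_{p,q})-2$; (3) if $z=1$, then $\pi$ is disconnected. Order this set by the transitive closure of the relation in which $(\pi,z)$ is related to $(\sigma,w)$ if either $z=w$ and $\pi\le\sigma$, or $z=0$, $w=1$, $\pi$ is connected, $\sigma$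 is disconnected and $\ell(\sigma)=\ell(\pi)+\ell(\pi^{-1}\sigma)-2$. Then the number of maximal chains of the poset $\overline{\mathcal S}^{A}_{\mathrm{nc}}(p,q)$ is $$\sum_{c\ge 1} c\binom{p+q}{p-c}p^{p-c}q^{q+c},$$ where the terms with $c>p$ are zero. Moreover, if $\mathcal F_{(p,q)}$ denotes the set of $(p+q)$-tuples $(\eta_1,\dots,\eta_{p+q})$ of transpositions in $\mathcal S_{p+q}$ such that $\eta_1\cdots\eta_{p+q}=\alpha_{p,q}$ and $\{\eta_1,\dots,\eta_{p+q}\}$ generates $\mathcal S_{p+q}$, then $$|\mathcal F_{(p,q)}|=\frac{pq}{p+q}\binom{p+q}{q}p^p q^q.$$ -/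

import Mathlib

open Equiv

namespace AnnularNC

/-- The absolute length of a permutation `π` of `{0, …, n - 1}`: the smallest `k` such that `π` is
a product of `k` transpositions. -/
noncomputable def absLength {n : ℕ} (π : Perm (Fin n)) : ℕ :=
  sInf {k : ℕ | ∃ l : List (Perm (Fin n)), (∀ t ∈ l, t.IsSwap) ∧ l.length = k ∧ l.prod = π}

/-- The absolute order: `π ≤ σ` iff `ℓ(σ) = ℓ(π) + ℓ(π⁻¹ σ)`. -/
def AbsLE {n : ℕ} (π σ : Perm (Fin n)) : Prop :=
  absLength σ = absLength π + absLength (π⁻¹ * σ)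

/-- The permutation `(1 … p)(p+1 … p+q)`, on the index set `{0, …, p + q - 1}`. -/
def alpha (p q : ℕ) : Perm (Fin (p + q)) :=
  finSumFinEquiv.permCongr (Perm.sumCongr (finRotate p) (finRotate q))

/-- `π` is connected: some cycle of `π` meets both the block of the first `p` letters and the block
of the last `q` letters. -/
def Connected {p q : ℕ} (π : Perm (Fin (p + q))) : Prop :=
  ∃ (i : Fin p) (j : Fin q), π.SameCycle (Fin.castAdd q i) (Fin.natAdd p j)

/-- Marked annular noncrossing permutations of type `A`. The equation with `- 2` for connected
permutations is written with `+ 2` on the other side, since it lives in `ℕ`. -/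
@[ext]
structure MarkedNC (p q : ℕ) where
  perm : Perm (Fin (p + q))
  mark : Fin 2
  le_of_disconnected : ¬ Connected perm → AbsLE perm (alpha p q)
  length_of_connected : Connected perm →
    absLength (alpha p q) + 2 = absLength perm + absLength (perm⁻¹ * alpha p q)
  disconnected_of_mark : mark = 1 → ¬ Connected perm

/-- The two comparabilities generating the order: equal marks and absolute order, or a passage from
a connected permutation with mark `0` to a disconnected permutation with mark `1`. -/
def MarkedNC.BasicLE {p q : ℕ} (x y : MarkedNC p q) : Prop :=
  (x.mark = y.mark ∧ AbsLE x.perm y.perm) ∨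
  (x.mark = 0 ∧ y.mark = 1 ∧ Connected x.perm ∧ ¬ Connected y.perm ∧
    absLength y.perm + 2 = absLength x.perm + absLength (x.perm⁻¹ * y.perm))

theorem exists_swap_list {n : ℕ} (π : Perm (Fin n)) :
    ∃ l : List (Perm (Fin n)), (∀ t ∈ l, t.IsSwap) ∧ l.length = absLength π ∧ l.prod = π := by
  have hne : {k : ℕ | ∃ l : List (Perm (Fin n)),
      (∀ t ∈ l, t.IsSwap) ∧ l.length = k ∧ l.prod = π}.Nonempty := by
    obtain ⟨⟨l, hl, hs⟩⟩ := Perm.truncSwapFactors π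
    exact ⟨l.length, l, hs, rfl, hl⟩
  exact Nat.sInf_mem hne

theorem eq_one_of_absLength_eq_zero {n : ℕ} {π : Perm (Fin n)} (h : absLength π = 0) : π = 1 := by
  obtain ⟨l, -, hl, rfl⟩ := exists_swap_list π
  rw [h] at hl
  rw [List.length_eq_zero_iff.1 hl, List.prod_nil]

/-- The rank function `ℓ(π) + 2 z`. -/
noncomputable def MarkedNC.rank {p q : ℕ} (x : MarkedNC p q) : ℕ :=
  absLength x.perm + 2 * (x.mark : ℕ)

theorem MarkedNC.BasicLE.rank_lt_or_eq {p q : ℕ} {x y : MarkedNC p q} (h : x.BasicLE y) :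
    x.rank < y.rank ∨ x = y := by
  have key : absLength (x.perm⁻¹ * y.perm) = 0 → x.perm = y.perm := fun h0 =>
    inv_mul_eq_one.1 (eq_one_of_absLength_eq_zero h0)
  rcases h with ⟨hm, hle⟩ | ⟨hx, hy, hcx, hcy, hle⟩
  · rcases Nat.eq_zero_or_pos (absLength (x.perm⁻¹ * y.perm)) with h0 | h0
    · exact Or.inr (MarkedNC.ext (key h0) hm)
    · left
      unfold AbsLE at hle
      unfold MarkedNC.rank
      rw [hm]
      omega
  · rcases Nat.eq_zero_or_pos (absLength (x.perm⁻¹ * y.perm)) with h0 | h0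
    · exact absurd (key h0 ▸ hcx) hcy
    · left
      unfold MarkedNC.rank
      rw [hx, hy]
      simp only [Fin.val_zero, Fin.val_one]
      omega

theorem MarkedNC.rank_lt_or_eq_of_reflTransGen {p q : ℕ} {x y : MarkedNC p q}
    (h : Relation.ReflTransGen MarkedNC.BasicLE x y) : x.rank < y.rank ∨ x = y := by
  induction h with
  | refl => exact Or.inr rfl
  | tail _ hbc ih =>
    rcases hbc.rank_lt_or_eq with h1 | rfl
    · rcases ih with h2 | rfl
      · exact Or.inl (h2.trans h1)
      · exact Or.inl h1
    · exact ih

/-- The partial order on marked annular noncrossing permutations: the (reflexive and) transitive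
closure of the two basic comparabilities. -/
instance MarkedNC.instPartialOrder (p q : ℕ) : PartialOrder (MarkedNC p q) where
  le := Relation.ReflTransGen MarkedNC.BasicLE
  le_refl _ := Relation.ReflTransGen.refl
  le_trans _ _ _ := Relation.ReflTransGen.trans
  le_antisymm x y hxy hyx := by
    rcases MarkedNC.rank_lt_or_eq_of_reflTransGen hxy with h1 | h1
    · rcases MarkedNC.rank_lt_or_eq_of_reflTransGen hyx with h2 | h2
      · omega
      · exact h2.symm
    · exact h1

/-- Minimal transitive factorizations of `(1 … p)(p+1 … p+q)`: the `(p + q)`-tuples of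
transpositions whose product is that permutation and which generate the symmetric group. -/
def MinTransFact (p q : ℕ) : Set (Fin (p + q) → Perm (Fin (p + q))) :=
  {η | (∀ i, (η i).IsSwap) ∧ (List.ofFn η).prod = alpha p q ∧
    Subgroup.closure (Set.range η) = ⊤}

end AnnularNC

namespace AnnularNC

open Finset
open Function hiding swap

set_option linter.unusedSectionVars false

/-- Abel's binomial identity, with the term `k = n` left out. -/
theorem sum_choose_mul_abel (n : ℕ) (x : ℝ) :
    ∑ k ∈ range n, (n.choose k : ℝ) * (x + k) ^ k * ((n - k : ℕ) : ℝ) ^ (n - k - 1) =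
      n * (x + n) ^ (n - 1) := by
  induction n generalizing x with
  | zero => simp
  | succ n ih =>
    rcases Nat.eq_zero_or_pos n with rfl | hn
    · simp
    set f : ℝ → ℝ := fun x => ∑ k ∈ range (n + 1), ((n + 1).choose k : ℝ) * (x + k) ^ k *
      ((n + 1 - k : ℕ) : ℝ) ^ (n + 1 - k - 1) - ((n + 1 : ℕ) : ℝ) * (x + (n + 1 : ℕ)) ^ (n + 1 - 1)
      with hf
    have hder : ∀ y, HasDerivAt f 0 y := by
      intro y
      have h1 : HasDerivAt f (∑ k ∈ range (n + 1), ((n + 1).choose k : ℝ) *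
          (k * (y + k) ^ (k - 1)) * ((n + 1 - k : ℕ) : ℝ) ^ (n + 1 - k - 1) -
          ((n + 1 : ℕ) : ℝ) * (n * (y + (n + 1 : ℕ)) ^ (n - 1))) y := by
        refine HasDerivAt.sub (HasDerivAt.fun_sum fun k _ => ?_) ?_
        · refine HasDerivAt.mul_const (HasDerivAt.const_mul _ ?_) _
          simpa using ((hasDerivAt_id y).add_const (k : ℝ)).fun_pow k
        · refine HasDerivAt.const_mul _ ?_
          simpa using ((hasDerivAt_id y).add_const (((n + 1 : ℕ)) : ℝ)).fun_pow n
      convert h1 using 1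
      rw [sum_range_succ']
      have h2 : ∀ k ∈ range n, ((n + 1).choose (k + 1) : ℝ) *
          (((k + 1 : ℕ) : ℝ) * (y + (k + 1 : ℕ)) ^ (k + 1 - 1)) *
          ((n + 1 - (k + 1) : ℕ) : ℝ) ^ (n + 1 - (k + 1) - 1) =
          ((n + 1 : ℕ) : ℝ) * ((n.choose k : ℝ) * ((y + 1) + k) ^ k *
            ((n - k : ℕ) : ℝ) ^ (n - k - 1)) := by
        intro k _
        have h3 : ((n + 1 : ℕ) : ℝ) * (n.choose k : ℝ) =
            ((n + 1).choose (k + 1) : ℝ) * ((k + 1 : ℕ) : ℝ) := by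
          exact_mod_cast Nat.add_one_mul_choose_eq n k
        rw [Nat.add_sub_cancel, Nat.add_sub_add_right, ← mul_assoc, ← mul_assoc, ← mul_assoc, ← h3]
        push_cast
        ring
      rw [sum_congr rfl h2, ← mul_sum, ih]
      push_cast
      ring
    have hconst : f x = f (-(n + 1 : ℕ)) :=
      is_const_of_deriv_eq_zero (fun y => (hder y).differentiableAt) (fun y => (hder y).deriv) _ _
    have hval : f (-(n + 1 : ℕ)) = 0 := by
      have h4 := congrFun (fwdDiff_iter_pow_eq_zero_of_lt (R := ℝ) (Nat.lt_succ_self n))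
        (-(n + 1 : ℕ))
      rw [fwdDiff_iter_eq_sum_shift] at h4
      rw [Pi.zero_apply, sum_range_succ] at h4
      simp only [hf]
      have h6 : (-((n + 1 : ℕ) : ℝ) + (n + 1 : ℕ)) ^ (n + 1 - 1) = 0 := by
        rw [neg_add_cancel]
        exact zero_pow (by omega)
      rw [h6, mul_zero, sub_zero, ← neg_eq_zero, ← h4]
      have h7 : (-((n + 1 : ℕ) : ℝ) + (n + 1) • (1 : ℝ)) ^ n = 0 := by
        rw [nsmul_eq_mul, mul_one, neg_add_cancel]
        exact zero_pow (by omega)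
      rw [Nat.succ_eq_add_one, h7, smul_zero, add_zero, ← sum_neg_distrib]
      refine sum_congr rfl fun k hk => ?_
      have hk' : k < n + 1 := mem_range.1 hk
      have hsub : (-((n + 1 : ℕ) : ℝ) + k) = -((n + 1 - k : ℕ) : ℝ) := by
        rw [Nat.cast_sub hk'.le]
        ring
      rw [nsmul_eq_mul, mul_one, hsub, zsmul_eq_mul]
      push_cast
      obtain ⟨j, rfl⟩ : ∃ j, n = k + j := ⟨n - k, by omega⟩
      have e1 : k + j + 1 - k = j + 1 := by omega
      rw [e1, Nat.add_sub_cancel, neg_pow (((j + 1 : ℕ) : ℝ)) k,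
        neg_pow (((j + 1 : ℕ) : ℝ)) (k + j), pow_add (-1 : ℝ) k j, pow_succ (-1 : ℝ) j,
        pow_add ((j + 1 : ℕ) : ℝ) k j]
      have e2 : (-1 : ℝ) ^ j * (-1) ^ j = 1 := by
        rw [← mul_pow]; norm_num
      linear_combination ((((k + j + 1).choose k : ℝ) * (-1) ^ k * ((j + 1 : ℕ) : ℝ) ^ k * ((j + 1 : ℕ) : ℝ) ^ j)) * e2
    have := hconst.trans hval
    simp only [hf] at this
    linarith

/-- Partial sums of the first moment of the binomial distribution telescope. -/
theorem sum_range_choose_telescope (M : ℕ) (x y : ℝ) (m : ℕ) (hm : m ≤ M + 1) :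
    ∑ s ∈ range m, (M.choose s : ℝ) * x ^ s * y ^ (M - s) * (((M : ℝ) - s) * x - s * y) =
      m * M.choose m * x ^ m * y ^ (M + 1 - m) := by
  induction m with
  | zero => simp
  | succ m ih =>
    rw [sum_range_succ, ih (by omega)]
    have h1 : ((M.choose (m + 1) : ℕ) : ℝ) * ((m + 1 : ℕ) : ℝ) = M.choose m * ((M : ℝ) - m) := by
      rw [← Nat.cast_sub (by omega)]
      exact_mod_cast Nat.choose_succ_right_eq M m
    have h2 : M + 1 - m = (M - m) + 1 := by omega
    have h3 : M + 1 - (m + 1) = M - m := by omega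
    rw [h2, h3, mul_comm ((m + 1 : ℕ) : ℝ) _, h1]
    ring

/-- The number `k ^ (k - 1) / k!`, the `k`-th coefficient of the tree function. -/
noncomputable def treeCoeff (k : ℕ) : ℝ := (k : ℝ) ^ (k - 1) / k.factorial

theorem treeCoeff_pos {k : ℕ} (hk : 0 < k) : 0 < treeCoeff k := by
  have : (0 : ℝ) < k := by exact_mod_cast hk
  unfold treeCoeff
  positivity

theorem sum_choose_eq_closed (p q : ℕ) (hp : 0 < p) (hq : 0 < q) :
    ∑ c ∈ Icc 1 p, (c : ℝ) * (p + q).choose (p - c) * (p : ℝ) ^ (p - c) * (q : ℝ) ^ (q + c) =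
      (p * q : ℝ) / (p + q) * (p + q).choose q * (p : ℝ) ^ p * (q : ℝ) ^ q := by
  have h0 : (0 : ℝ) < p := by exact_mod_cast hp
  have h0' : (0 : ℝ) < q := by exact_mod_cast hq
  have key := sum_range_choose_telescope (p + q) (p : ℝ) (q : ℝ) p (by omega)
  have h1 : ∑ c ∈ Icc 1 p, (c : ℝ) * (p + q).choose (p - c) * (p : ℝ) ^ (p - c) *
      (q : ℝ) ^ (q + c) =
      ∑ s ∈ range p, ((p : ℝ) - s) * (p + q).choose s * (p : ℝ) ^ s * (q : ℝ) ^ (p + q - s) := by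
    refine sum_bij' (fun c _ => p - c) (fun s _ => p - s) ?_ ?_ ?_ ?_ ?_
    · intro c hc; simp only [mem_Icc, mem_range] at *; omega
    · intro c hc; simp only [mem_Icc, mem_range] at *; omega
    · intro c hc; simp only [mem_Icc] at *; omega
    · intro c hc; simp only [mem_range] at *; omega
    · intro c hc
      simp only [mem_Icc] at hc
      rw [Nat.cast_sub hc.2, show p + q - (p - c) = q + c by omega]
      ring
  have h2 : ∑ s ∈ range p, ((p + q).choose s : ℝ) * (p : ℝ) ^ s * (q : ℝ) ^ (p + q - s) *
      ((((p + q : ℕ) : ℝ) - s) * p - s * q) = (p + q) *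
      ∑ s ∈ range p, ((p : ℝ) - s) * (p + q).choose s * (p : ℝ) ^ s * (q : ℝ) ^ (p + q - s) := by
    rw [mul_sum]
    refine sum_congr rfl fun s _ => ?_
    push_cast
    ring
  rw [h2, ← h1, Nat.choose_symm_add, show p + q + 1 - p = q + 1 by omega] at key
  have h3 : (0 : ℝ) < p + q := by positivity
  apply mul_left_cancel₀ h3.ne'
  rw [key]
  field_simp
  ring

theorem mul_treeCoeff {k : ℕ} (hk : 0 < k) : k * treeCoeff k = (k : ℝ) ^ k / k.factorial := by
  obtain ⟨j, rfl⟩ : ∃ j, k = j + 1 := ⟨k - 1, by omega⟩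
  rw [treeCoeff, Nat.add_sub_cancel]
  ring

theorem sum_mul_treeCoeff_mul {k : ℕ} (hk : 0 < k) :
    ∑ i ∈ Ioo 0 k, i * treeCoeff i * treeCoeff (k - i) = (k - 1) * treeCoeff k := by
  have h := sum_choose_mul_abel k 0
  obtain ⟨j, rfl⟩ : ∃ j, k = j + 1 := ⟨k - 1, by omega⟩
  have h1 : Ioo 0 (j + 1) = Ico 1 (j + 1) := by ext; simp [Nat.succ_le_iff]
  rw [range_eq_Ico, sum_eq_sum_Ico_succ_bot (by omega)] at h
  have h2 : ∀ i ∈ Ico (0 + 1) (j + 1), ((j + 1).choose i : ℝ) * (0 + (i : ℝ)) ^ i *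
      ((j + 1 - i : ℕ) : ℝ) ^ (j + 1 - i - 1) =
      (j + 1).factorial * (i * treeCoeff i * treeCoeff (j + 1 - i)) := by
    intro i hi
    rw [mem_Ico] at hi
    rw [mul_treeCoeff (by omega), treeCoeff, Nat.cast_choose ℝ (by omega : i ≤ j + 1), zero_add]
    field_simp
  rw [sum_congr rfl h2, ← mul_sum] at h
  rw [h1]
  have h3 : ((j + 1).factorial : ℝ) ≠ 0 := by positivity
  apply mul_left_cancel₀ h3
  rw [zero_add] at h
  simp only [Nat.choose_zero_right, Nat.sub_zero, Nat.add_sub_cancel, zero_add] at h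
  rw [treeCoeff, Nat.add_sub_cancel]
  field_simp
  push_cast at h ⊢
  linarith

theorem sum_treeCoeff_mul {k : ℕ} (hk : 0 < k) :
    ∑ i ∈ Ioo 0 k, treeCoeff i * treeCoeff (k - i) = 2 * (k - 1) / k * treeCoeff k := by
  have h0 : (0 : ℝ) < k := by exact_mod_cast hk
  have h := sum_mul_treeCoeff_mul hk
  have h' : ∑ i ∈ Ioo 0 k, ((k : ℝ) - i) * treeCoeff i * treeCoeff (k - i) =
      ∑ i ∈ Ioo 0 k, i * treeCoeff i * treeCoeff (k - i) := by
    refine sum_bij' (fun i _ => k - i) (fun i _ => k - i) ?_ ?_ ?_ ?_ ?_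
    · intro i hi; rw [mem_Ioo] at *; omega
    · intro i hi; rw [mem_Ioo] at *; omega
    · intro i hi; rw [mem_Ioo] at *; omega
    · intro i hi; rw [mem_Ioo] at *; omega
    · intro i hi
      rw [mem_Ioo] at hi
      rw [Nat.cast_sub hi.2.le, Nat.sub_sub_self hi.2.le]
      ring
  have h'' : (k : ℝ) * ∑ i ∈ Ioo 0 k, treeCoeff i * treeCoeff (k - i) =
      ∑ i ∈ Ioo 0 k, ((k : ℝ) - i) * treeCoeff i * treeCoeff (k - i) +
      ∑ i ∈ Ioo 0 k, i * treeCoeff i * treeCoeff (k - i) := by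
    rw [← sum_add_distrib, mul_sum]
    exact sum_congr rfl fun i _ => by ring
  apply mul_left_cancel₀ h0.ne'
  rw [h'', h', h]
  field_simp
  ring

theorem sum_treeCoeff_mul_pow {a c : ℕ} (hca : c < a) :
    ∑ i ∈ Ico c a, treeCoeff (a - i) * ((i : ℝ) ^ (i - c) / (i - c).factorial) =
      (a : ℝ) ^ (a - c - 1) / (a - c - 1).factorial := by
  obtain ⟨n, rfl⟩ : ∃ n, a = c + (n + 1) := ⟨a - c - 1, by omega⟩
  have h := sum_choose_mul_abel (n + 1) c
  rw [sum_Ico_eq_sum_range, Nat.add_sub_cancel_left, Nat.add_sub_cancel]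
  have h2 : ∀ i ∈ range (n + 1), ((n + 1).choose i : ℝ) * (c + (i : ℝ)) ^ i *
      ((n + 1 - i : ℕ) : ℝ) ^ (n + 1 - i - 1) =
      (n + 1).factorial * (treeCoeff (c + (n + 1) - (c + i)) *
        (((c + i : ℕ) : ℝ) ^ (c + i - c) / (c + i - c).factorial)) := by
    intro i hi
    rw [mem_range] at hi
    rw [Nat.add_sub_add_left, Nat.add_sub_cancel_left, treeCoeff,
      Nat.cast_choose ℝ (by omega : i ≤ n + 1)]
    push_cast
    field_simp
  rw [sum_congr rfl h2, ← mul_sum] at h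
  have h3 : ((n + 1).factorial : ℝ) ≠ 0 := by positivity
  apply mul_left_cancel₀ h3
  rw [h, Nat.add_sub_cancel, Nat.factorial_succ]
  push_cast
  field_simp

theorem treeCoeff_mul_eq_sum {a b : ℕ} (ha : 0 < a) (hb : 0 < b) :
    treeCoeff b * (treeCoeff a * (a * (a * b / (a + b)))) =
      ∑ c ∈ Icc 1 a, c * ((a : ℝ) ^ (a - c) / (a - c).factorial) *
        ((b : ℝ) ^ (b + c - 1) / (b + c).factorial) := by
  have h := sum_choose_eq_closed a b ha hb
  have hb0 : (b : ℝ) ≠ 0 := by exact_mod_cast hb.ne'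
  have ha0 : (a : ℝ) + b ≠ 0 := by positivity
  have h2 : ∀ c ∈ Icc 1 a, (c : ℝ) * (a + b).choose (a - c) * (a : ℝ) ^ (a - c) *
      (b : ℝ) ^ (b + c) = (a + b).factorial * b * (c * ((a : ℝ) ^ (a - c) / (a - c).factorial) *
        ((b : ℝ) ^ (b + c - 1) / (b + c).factorial)) := by
    intro c hc
    rw [mem_Icc] at hc
    rw [Nat.cast_choose ℝ (by omega : a - c ≤ a + b), show a + b - (a - c) = b + c by omega,
      show (b : ℝ) ^ (b + c) = b ^ (b + c - 1) * b by
        rw [← pow_succ, Nat.sub_add_cancel (by omega)]]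
    field_simp
  rw [sum_congr rfl h2, ← mul_sum] at h
  have h3 : ((a + b).factorial : ℝ) * b ≠ 0 := by positivity
  apply mul_left_cancel₀ h3
  rw [h, Nat.cast_choose ℝ (by omega : b ≤ a + b), Nat.add_sub_cancel]
  have h4 := mul_treeCoeff ha
  have h5 := mul_treeCoeff hb
  have h6 : (a + b).factorial * (b : ℝ) * (treeCoeff b * (treeCoeff a * (a * (a * b / (a + b))))) =
    (a + b).factorial * ((a * treeCoeff a) * (b * treeCoeff b)) * (a * b / (a + b)) := by ring
  rw [h6, h4, h5]
  field_simp

theorem sum_treeCoeff_convolution (a b : ℕ) (hb : 0 < b) :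
    ∑ i ∈ Ioo 0 a, treeCoeff b * (treeCoeff i * treeCoeff (a - i) * (i * (i * b / (i + b)))) =
      ∑ c ∈ range a, c * ((a : ℝ) ^ (a - c - 1) / (a - c - 1).factorial) *
        ((b : ℝ) ^ (b + c - 1) / (b + c).factorial) := by
  have h1 : ∀ i ∈ Ioo 0 a,
      treeCoeff b * (treeCoeff i * treeCoeff (a - i) * (i * (i * b / (i + b)))) =
      ∑ c ∈ Icc 1 i, treeCoeff (a - i) * (c * ((i : ℝ) ^ (i - c) / (i - c).factorial) *
        ((b : ℝ) ^ (b + c - 1) / (b + c).factorial)) := by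
    intro i hi
    rw [← mul_sum, ← treeCoeff_mul_eq_sum (mem_Ioo.1 hi).1 hb]
    ring
  rw [sum_congr rfl h1]
  have h2 : ∑ i ∈ Ioo 0 a, ∑ c ∈ Icc 1 i, treeCoeff (a - i) *
      (c * ((i : ℝ) ^ (i - c) / (i - c).factorial) * ((b : ℝ) ^ (b + c - 1) / (b + c).factorial)) =
      ∑ c ∈ Ioo 0 a, ∑ i ∈ Ico c a, treeCoeff (a - i) *
      (c * ((i : ℝ) ^ (i - c) / (i - c).factorial) *
        ((b : ℝ) ^ (b + c - 1) / (b + c).factorial)) := by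
    apply sum_comm'
    intro i c
    simp only [mem_Ioo, mem_Icc, mem_Ico]
    omega
  rw [h2, range_eq_Ico]
  rcases Nat.eq_zero_or_pos a with rfl | ha
  · simp
  rw [sum_eq_sum_Ico_succ_bot ha]
  have h3 : Ioo 0 a = Ico (0 + 1) a := by ext; simp [Nat.succ_le_iff]
  rw [h3]
  simp only [Nat.cast_zero, zero_mul, zero_add]
  refine sum_congr rfl fun c hc => ?_
  rw [← sum_treeCoeff_mul_pow (mem_Ico.1 hc).2, mul_sum, sum_mul]
  exact sum_congr rfl fun i _ => by ring

/-- The join-cut recursion for the two-cycle weights. -/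
theorem treeCoeff_join_cut {a b : ℕ} (ha : 0 < a) (hb : 0 < b) :
    (a + b) * (a * b / (a + b)) * (treeCoeff a * treeCoeff b) =
      treeCoeff b * (∑ i ∈ Ioo 0 a, treeCoeff i * treeCoeff (a - i) * (i * (i * b / (i + b)))) +
      treeCoeff a * (∑ j ∈ Ioo 0 b, treeCoeff j * treeCoeff (b - j) * (j * (j * a / (j + a)))) +
      treeCoeff (a + b) := by
  rw [mul_sum, mul_sum, sum_treeCoeff_convolution a b hb, sum_treeCoeff_convolution b a ha]
  obtain ⟨M, hM⟩ : ∃ M, a + b = M + 1 := ⟨a + b - 1, by omega⟩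
  have hMr : (a : ℝ) + b = M + 1 := by exact_mod_cast hM
  have ha0 : (a : ℝ) ≠ 0 := by positivity
  have hb0 : (b : ℝ) ≠ 0 := by positivity
  set w : ℕ → ℝ := fun s => (M.choose s : ℝ) * (b : ℝ) ^ s * (a : ℝ) ^ (M - s) with hw
  have e1 : ∑ c ∈ range a, c * ((a : ℝ) ^ (a - c - 1) / (a - c - 1).factorial) *
        ((b : ℝ) ^ (b + c - 1) / (b + c).factorial) =
      (1 / (M.factorial * b)) * ∑ s ∈ Ico b (M + 1), ((s : ℝ) - b) * w s := by
    rw [sum_Ico_eq_sum_range, show M + 1 - b = a by omega, mul_sum]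
    refine sum_congr rfl fun c hc => ?_
    rw [mem_range] at hc
    simp only [hw]
    rw [Nat.cast_choose ℝ (by omega : b + c ≤ M), show M - (b + c) = a - c - 1 by omega,
      show (b : ℝ) ^ (b + c) = b ^ (b + c - 1) * b by
        rw [← pow_succ, Nat.sub_add_cancel (by omega)]]
    push_cast
    field_simp
    ring
  have e2 : ∑ c ∈ range b, c * ((b : ℝ) ^ (b - c - 1) / (b - c - 1).factorial) *
        ((a : ℝ) ^ (a + c - 1) / (a + c).factorial) =
      (1 / (M.factorial * a)) * ∑ s ∈ range b, ((b : ℝ) - 1 - s) * w s := by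
    rw [← sum_range_reflect, mul_sum]
    refine sum_congr rfl fun s hs => ?_
    rw [mem_range] at hs
    simp only [hw]
    rw [Nat.cast_choose ℝ (by omega : s ≤ M), show b - (b - 1 - s) - 1 = s by omega,
      show a + (b - 1 - s) = M - s by omega,
      show (a : ℝ) ^ (M - s) = a ^ (M - s - 1) * a by
        rw [← pow_succ, Nat.sub_add_cancel (by omega)], Nat.cast_sub (by omega),
      Nat.cast_sub (by omega)]
    push_cast
    field_simp
  have t1 := sum_range_choose_telescope M (b : ℝ) (a : ℝ) b (by omega)
  have t2 := sum_range_choose_telescope M (b : ℝ) (a : ℝ) (M + 1) le_rfl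
  have tot : ∑ s ∈ range (M + 1), w s = ((M : ℝ) + 1) ^ M := by
    rw [← hMr, add_comm (a : ℝ), add_pow]
    exact sum_congr rfl fun s _ => by simp only [hw]; ring
  rw [← sum_range_add_sum_Ico _ (show b ≤ M + 1 by omega)] at tot t2
  rw [t1, Nat.choose_succ_self, Nat.cast_zero, mul_zero, zero_mul, zero_mul] at t2
  have f1 : ((M : ℝ) + 1) * ∑ s ∈ Ico b (M + 1), ((s : ℝ) - b) * w s =
      -(∑ s ∈ Ico b (M + 1), (M.choose s : ℝ) * (b : ℝ) ^ s * (a : ℝ) ^ (M - s) *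
        (((M : ℝ) - s) * b - s * a)) - b * ∑ s ∈ Ico b (M + 1), w s := by
    rw [mul_sum, mul_sum, ← sum_neg_distrib, ← sum_sub_distrib]
    refine sum_congr rfl fun s _ => ?_
    simp only [hw]
    linear_combination (-(M.choose s : ℝ) * (b : ℝ) ^ s * (a : ℝ) ^ (M - s)) * s * hMr
  have f2 : ((M : ℝ) + 1) * ∑ s ∈ range b, ((b : ℝ) - 1 - s) * w s =
      (∑ s ∈ range b, (M.choose s : ℝ) * (b : ℝ) ^ s * (a : ℝ) ^ (M - s) *
        (((M : ℝ) - s) * b - s * a)) - a * ∑ s ∈ range b, w s := by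
    rw [mul_sum, mul_sum, ← sum_sub_distrib]
    refine sum_congr rfl fun s _ => ?_
    simp only [hw]
    linear_combination ((M.choose s : ℝ) * (b : ℝ) ^ s * (a : ℝ) ^ (M - s)) * (s + 1) * hMr
  rw [t1] at f2
  rw [e1, e2]
  have hM1 : (M : ℝ) + 1 ≠ 0 := by positivity
  have hch : (b : ℝ) * M.choose b * b ^ b * a ^ (M + 1 - b) =
      M.factorial * (a * b) * ((a * treeCoeff a) * (b * treeCoeff b)) := by
    rw [mul_treeCoeff ha, mul_treeCoeff hb, show M + 1 - b = a by omega,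
      Nat.cast_choose ℝ (by omega : b ≤ M), show a.factorial = a * (M - b).factorial by
        rw [show a = (M - b) + 1 by omega, Nat.factorial_succ]]
    push_cast
    field_simp
  have hg : treeCoeff (a + b) = (M + 1 : ℝ) ^ M / ((M + 1) * M.factorial) := by
    rw [hM, treeCoeff, Nat.add_sub_cancel, Nat.factorial_succ]
    push_cast
    rfl
  rw [hg, hMr]
  rw [hch] at f2 t2
  have hMf : (M.factorial : ℝ) ≠ 0 := by positivity
  field_simp
  linear_combination (-b : ℝ) * f2 - (a : ℝ) * f1 + (a : ℝ) * t2 + a * b * tot -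
    M.factorial * (a * b) * ((a * treeCoeff a) * (b * treeCoeff b)) * hMr

section Cycles

variable {V : Type*} [Finite V]

/-- The length of the cycle of `σ` through `x`. -/
noncomputable def cycleLen (σ : Perm V) (x : V) : ℕ := minimalPeriod σ x

theorem mem_periodicPts_perm (σ : Perm V) (x : V) : x ∈ periodicPts σ :=
  mk_mem_periodicPts (orderOf_pos σ) (by
    rw [IsPeriodicPt, IsFixedPt, Perm.iterate_eq_pow, pow_orderOf_eq_one, Perm.one_apply])

theorem cycleLen_pos (σ : Perm V) (x : V) : 0 < cycleLen σ x :=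
  minimalPeriod_pos_of_mem_periodicPts (mem_periodicPts_perm σ x)

theorem iterate_cycleLen (σ : Perm V) (x : V) : σ^[cycleLen σ x] x = x :=
  iterate_minimalPeriod

theorem cycleLen_iterate (σ : Perm V) (x : V) (j : ℕ) : cycleLen σ (σ^[j] x) = cycleLen σ x :=
  minimalPeriod_apply_iterate (mem_periodicPts_perm σ x) j

theorem iterate_ne_self {σ : Perm V} {x : V} {j : ℕ} (h0 : 0 < j) (hj : j < cycleLen σ x) :
    σ^[j] x ≠ x := fun h =>
  not_isPeriodicPt_of_pos_of_lt_minimalPeriod h0.ne' hj h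

theorem iterate_inj {σ : Perm V} {x : V} {i j : ℕ} (hi : i < cycleLen σ x) (hj : j < cycleLen σ x)
    (h : σ^[i] x = σ^[j] x) : i = j :=
  (iterate_eq_iterate_iff_of_lt_minimalPeriod hi hj).1 h

theorem cycleLen_eq {σ : Perm V} {x : V} {m : ℕ} (h0 : 0 < m) (h1 : σ^[m] x = x)
    (h2 : ∀ j, 0 < j → j < m → σ^[j] x ≠ x) : cycleLen σ x = m := by
  have hle : cycleLen σ x ≤ m := IsPeriodicPt.minimalPeriod_le h0 h1
  rcases hle.lt_or_eq with h | h
  · exact absurd (iterate_cycleLen σ x) (h2 _ (cycleLen_pos σ x) h)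
  · exact h

theorem sameCycle_iterate (σ : Perm V) (x : V) (j : ℕ) : σ.SameCycle x (σ^[j] x) :=
  ⟨j, by rw [Perm.iterate_eq_pow, zpow_natCast]⟩

theorem exists_iterate_of_sameCycle {σ : Perm V} {x y : V} (h : σ.SameCycle x y) :
    ∃ j < cycleLen σ x, σ^[j] x = y := by
  obtain ⟨m, hm⟩ := h.exists_nat_pow_eq
  refine ⟨m % cycleLen σ x, Nat.mod_lt _ (cycleLen_pos σ x), ?_⟩
  rw [← hm, ← Perm.iterate_eq_pow]
  exact iterate_mod_minimalPeriod_eq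

variable [DecidableEq V]

theorem swap_mul_iterate {σ : Perm V} {x y z : V} {m : ℕ}
    (h : ∀ j, 0 < j → j ≤ m → σ^[j] z ≠ x ∧ σ^[j] z ≠ y) :
    (swap x y * σ)^[m] z = σ^[m] z := by
  induction m with
  | zero => rfl
  | succ m ih =>
    have h1 := h (m + 1) (by omega) le_rfl
    rw [iterate_succ_apply', ih fun j h0 hj => h j h0 (by omega), Perm.mul_apply,
      ← iterate_succ_apply' σ, swap_apply_of_ne_of_ne h1.1 h1.2]

theorem cycleLen_swap_mul_of_not_sameCycle {σ : Perm V} {x y z : V} (hx : ¬ σ.SameCycle z x)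
    (hy : ¬ σ.SameCycle z y) : cycleLen (swap x y * σ) z = cycleLen σ z := by
  have h : ∀ m, (swap x y * σ)^[m] z = σ^[m] z := fun m =>
    swap_mul_iterate fun j _ _ => ⟨fun h => hx (h ▸ sameCycle_iterate σ z j),
      fun h => hy (h ▸ sameCycle_iterate σ z j)⟩
  refine minimalPeriod_eq_minimalPeriod_iff.2 fun m => ?_
  rw [IsPeriodicPt, IsPeriodicPt, IsFixedPt, IsFixedPt, h]

section Cut

variable {σ : Perm V} {x : V} {i : ℕ} (h0 : 0 < i) (hi : i < cycleLen σ x)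

include h0 hi

theorem cut_iterate_left {m : ℕ} (hm : m < i) :
    (swap x (σ^[i] x) * σ)^[m] x = σ^[m] x :=
  swap_mul_iterate fun j hj hjm => ⟨iterate_ne_self hj (by omega), fun h => by
    have := iterate_inj (by omega) hi h
    omega⟩

theorem cut_iterate_right {m : ℕ} (hm : m < cycleLen σ x - i) :
    (swap x (σ^[i] x) * σ)^[m] (σ^[i] x) = σ^[m + i] x := by
  rw [iterate_add_apply]
  refine swap_mul_iterate fun j hj hjm => ?_
  rw [← iterate_add_apply]
  refine ⟨iterate_ne_self (by omega) (by omega), fun h => ?_⟩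
  have := iterate_inj (by omega) hi h
  omega

theorem cycleLen_cut_left : cycleLen (swap x (σ^[i] x) * σ) x = i := by
  refine cycleLen_eq h0 ?_ fun j hj hji => ?_
  · obtain ⟨m, rfl⟩ : ∃ m, i = m + 1 := ⟨i - 1, by omega⟩
    rw [iterate_succ_apply', cut_iterate_left h0 hi (by omega), Perm.mul_apply,
      ← iterate_succ_apply' σ, swap_apply_right]
  · rw [cut_iterate_left h0 hi hji]
    exact iterate_ne_self hj (by omega)

theorem cycleLen_cut_right :
    cycleLen (swap x (σ^[i] x) * σ) (σ^[i] x) = cycleLen σ x - i := by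
  refine cycleLen_eq (by omega) ?_ fun j hj hji => ?_
  · obtain ⟨m, hm⟩ : ∃ m, cycleLen σ x - i = m + 1 := ⟨cycleLen σ x - i - 1, by omega⟩
    rw [hm, iterate_succ_apply', cut_iterate_right h0 hi (by omega), Perm.mul_apply,
      ← iterate_succ_apply' σ, show (m + i).succ = cycleLen σ x by omega, iterate_cycleLen,
      swap_apply_left]
  · rw [cut_iterate_right h0 hi hji]
    intro h
    have := iterate_inj (by omega) hi h
    omega

theorem cycleLen_cut_iterate {j : ℕ} (hj : j < cycleLen σ x) :
    cycleLen (swap x (σ^[i] x) * σ) (σ^[j] x) = if j < i then i else cycleLen σ x - i := by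
  split_ifs with h
  · rw [← cut_iterate_left h0 hi h, cycleLen_iterate, cycleLen_cut_left h0 hi]
  · rw [← cycleLen_cut_right h0 hi, ← cycleLen_iterate _ (σ^[i] x) (j - i),
      cut_iterate_right h0 hi (by omega), Nat.sub_add_cancel (by omega)]

@[to_additive]
theorem prod_cycleLen_cut {M : Type*} [CommMonoid M] (f : ℕ → M) (S : Finset V)
    (hS : ∀ j, σ^[j] x ∈ S) :
    (∏ z ∈ S, f (cycleLen (swap x (σ^[i] x) * σ) z)) * f (cycleLen σ x) ^ cycleLen σ x =
      (∏ z ∈ S, f (cycleLen σ z)) * (f i ^ i * f (cycleLen σ x - i) ^ (cycleLen σ x - i)) := by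
  set k := cycleLen σ x with hk
  set C := (range k).image (fun j => σ^[j] x) with hC
  have hinj : Set.InjOn (fun j => σ^[j] x) (range k : Finset ℕ) := fun a ha b hb h => by
    rw [coe_range, Set.mem_Iio] at ha hb
    exact iterate_inj ha hb h
  have hCS : C ⊆ S := by
    intro z hz
    obtain ⟨j, -, rfl⟩ := mem_image.1 hz
    exact hS j
  have hout : ∀ z ∈ S \ C, f (cycleLen (swap x (σ^[i] x) * σ) z) = f (cycleLen σ z) := by
    intro z hz
    have hzx : ¬ σ.SameCycle z x := by
      intro h
      obtain ⟨j, hj, rfl⟩ := exists_iterate_of_sameCycle h.symm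
      exact (mem_sdiff.1 hz).2 (mem_image_of_mem _ (mem_range.2 hj))
    rw [cycleLen_swap_mul_of_not_sameCycle hzx
      fun h => hzx (h.trans (sameCycle_iterate σ x i).symm)]
  have h1 : ∏ z ∈ C, f (cycleLen (swap x (σ^[i] x) * σ) z) = f i ^ i * f (k - i) ^ (k - i) := by
    rw [hC, prod_image hinj, ← prod_range_mul_prod_Ico _ hi.le]
    congr 1
    · rw [prod_congr rfl fun j hj => by
        rw [cycleLen_cut_iterate h0 hi ((mem_range.1 hj).trans hi), if_pos (mem_range.1 hj)],
        prod_const, card_range]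
    · rw [prod_congr rfl fun j hj => by
        rw [cycleLen_cut_iterate h0 hi (mem_Ico.1 hj).2, if_neg (not_lt.2 (mem_Ico.1 hj).1)],
        prod_const, Nat.card_Ico]
  have h2 : ∏ z ∈ C, f (cycleLen σ z) = f k ^ k := by
    rw [hC, prod_image hinj, prod_congr rfl fun j _ => by rw [cycleLen_iterate], prod_const,
      card_range]
  rw [← prod_sdiff hCS, ← prod_sdiff (f := fun z => f (cycleLen σ z)) hCS, prod_congr rfl hout,
    h1, h2, mul_right_comm]

end Cut

theorem iterate_join {σ : Perm V} {x y : V} (h : ¬ σ.SameCycle x y) :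
    (swap x y * σ)^[cycleLen σ x] x = y := by
  obtain ⟨m, hm⟩ : ∃ m, cycleLen σ x = m + 1 := ⟨cycleLen σ x - 1, by
    have := cycleLen_pos σ x
    omega⟩
  rw [hm, iterate_succ_apply', swap_mul_iterate, Perm.mul_apply, ← iterate_succ_apply' σ,
    Nat.succ_eq_add_one, ← hm, iterate_cycleLen, swap_apply_left]
  exact fun j hj hjm => ⟨iterate_ne_self hj (by omega),
    fun hy => h (hy ▸ sameCycle_iterate σ x j)⟩

theorem sameCycle_join {σ : Perm V} {x y : V} (h : ¬ σ.SameCycle x y) :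
    (swap x y * σ).SameCycle x y := by
  have := sameCycle_iterate (swap x y * σ) x (cycleLen σ x)
  rwa [iterate_join h] at this

/-- Every permutation in which `x` and `y` lie in one cycle is cut by `swap x y`. -/
theorem exists_cut {σ : Perm V} {x y : V} (hxy : x ≠ y) (h : σ.SameCycle x y) :
    ∃ i, 0 < i ∧ i < cycleLen σ x ∧ σ^[i] x = y := by
  obtain ⟨i, hi, rfl⟩ := exists_iterate_of_sameCycle h
  refine ⟨i, Nat.pos_of_ne_zero ?_, hi, rfl⟩
  rintro rfl
  exact hxy rfl

theorem cycleLen_join {σ : Perm V} {x y : V} (h : ¬ σ.SameCycle x y) :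
    cycleLen (swap x y * σ) x = cycleLen σ x + cycleLen σ y := by
  have hxy : x ≠ y := fun e => h (e ▸ Perm.SameCycle.refl _ _)
  obtain ⟨i, h0, hi, hy⟩ := exists_cut hxy (sameCycle_join h)
  have h1 := cycleLen_cut_left h0 hi
  have h2 := cycleLen_cut_right h0 hi
  rw [hy, swap_mul_self_mul] at h1 h2
  omega

@[to_additive]
theorem prod_cycleLen_join {M : Type*} [CommMonoid M] (f : ℕ → M) {σ : Perm V} {x y : V}
    (h : ¬ σ.SameCycle x y) (S : Finset V) (hS : ∀ j, (swap x y * σ)^[j] x ∈ S) :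
    (∏ z ∈ S, f (cycleLen σ z)) *
        f (cycleLen σ x + cycleLen σ y) ^ (cycleLen σ x + cycleLen σ y) =
      (∏ z ∈ S, f (cycleLen (swap x y * σ) z)) *
        (f (cycleLen σ x) ^ cycleLen σ x * f (cycleLen σ y) ^ cycleLen σ y) := by
  have hlt : cycleLen σ x < cycleLen (swap x y * σ) x := by
    rw [cycleLen_join h]
    have := cycleLen_pos σ y
    omega
  have := prod_cycleLen_cut (cycleLen_pos σ x) hlt f S hS
  rwa [iterate_join h, swap_mul_self_mul, cycleLen_join h, Nat.add_sub_cancel_left] at this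

end Cycles

section Length

variable {n : ℕ}

theorem absLength_le_of_list {σ : Perm (Fin n)} (l : List (Perm (Fin n)))
    (hl : ∀ t ∈ l, t.IsSwap) (h : l.prod = σ) : absLength σ ≤ l.length :=
  Nat.sInf_le ⟨l, hl, rfl, h⟩

theorem absLength_one : absLength (1 : Perm (Fin n)) = 0 :=
  Nat.le_zero.1 (absLength_le_of_list [] (by simp) rfl)

theorem absLength_mul_le (σ τ : Perm (Fin n)) :
    absLength (σ * τ) ≤ absLength σ + absLength τ := by
  obtain ⟨l, hl, hlen, hprod⟩ := exists_swap_list σ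
  obtain ⟨m, hm, hmlen, hmprod⟩ := exists_swap_list τ
  rw [← hlen, ← hmlen, ← List.length_append]
  refine absLength_le_of_list _ (fun t ht => ?_) (by rw [List.prod_append, hprod, hmprod])
  exact (List.mem_append.1 ht).elim (hl t) (hm t)

theorem isSwap_inv {t : Perm (Fin n)} (ht : t.IsSwap) : t⁻¹ = t := by
  obtain ⟨x, y, -, rfl⟩ := ht
  exact swap_inv x y

theorem absLength_inv_le (σ : Perm (Fin n)) : absLength σ⁻¹ ≤ absLength σ := by
  obtain ⟨l, hl, hlen, hprod⟩ := exists_swap_list σ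
  rw [← hlen, ← List.length_reverse]
  refine absLength_le_of_list _ (fun t ht => hl t (List.mem_reverse.1 ht)) ?_
  rw [← hprod, List.prod_inv_reverse, List.map_congr_left fun t ht => isSwap_inv (hl t ht),
    List.map_id']

theorem absLength_inv (σ : Perm (Fin n)) : absLength σ⁻¹ = absLength σ :=
  (absLength_inv_le σ).antisymm (by simpa using absLength_inv_le σ⁻¹)

theorem absLength_eq_one_iff {t : Perm (Fin n)} : absLength t = 1 ↔ t.IsSwap := by
  constructor
  · intro h
    obtain ⟨l, hl, hlen, hprod⟩ := exists_swap_list t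
    rw [h, List.length_eq_one_iff] at hlen
    obtain ⟨s, rfl⟩ := hlen
    rw [List.prod_singleton] at hprod
    exact hprod ▸ hl s (by simp)
  · intro h
    have h1 : absLength t ≤ 1 := absLength_le_of_list [t] (by simpa using h) (by simp)
    have h2 : absLength t ≠ 0 := by
      intro h0
      obtain ⟨x, y, hxy, rfl⟩ := h
      have h3 := congrArg (fun σ => σ x) (eq_one_of_absLength_eq_zero h0)
      simp only [swap_apply_left, Perm.one_apply] at h3
      exact hxy h3.symm
    omega

/-- The absolute length computed from the cycle lengths, one term for each letter. -/
noncomputable def cycleSum (σ : Perm (Fin n)) : ℝ := ∑ z, (1 - 1 / (cycleLen σ z : ℝ))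

theorem cycleSum_nonneg (σ : Perm (Fin n)) : 0 ≤ cycleSum σ := by
  refine sum_nonneg fun z _ => ?_
  have : (1 : ℝ) ≤ cycleLen σ z := by exact_mod_cast cycleLen_pos σ z
  rw [sub_nonneg]
  exact (div_le_one (by linarith)).2 this

theorem cycleSum_one : cycleSum (1 : Perm (Fin n)) = 0 := by
  refine sum_eq_zero fun z _ => ?_
  have : cycleLen (1 : Perm (Fin n)) z = 1 := minimalPeriod_id
  rw [this]
  norm_num

theorem nsmul_one_sub_inv {k : ℕ} (hk : 0 < k) : k • (1 - 1 / (k : ℝ)) = k - 1 := by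
  have : (k : ℝ) ≠ 0 := by positivity
  rw [nsmul_eq_mul]
  field_simp

theorem cycleSum_cut {σ : Perm (Fin n)} {x y : Fin n} (hxy : x ≠ y) (h : σ.SameCycle x y) :
    cycleSum (swap x y * σ) + 1 = cycleSum σ := by
  obtain ⟨i, h0, hi, rfl⟩ := exists_cut hxy h
  have := sum_cycleLen_cut h0 hi (fun k => 1 - 1 / (k : ℝ)) univ fun _ => mem_univ _
  rw [nsmul_one_sub_inv (cycleLen_pos σ x), nsmul_one_sub_inv h0,
    nsmul_one_sub_inv (by omega), Nat.cast_sub hi.le] at this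
  unfold cycleSum
  linarith

theorem cycleSum_join {σ : Perm (Fin n)} {x y : Fin n} (h : ¬ σ.SameCycle x y) :
    cycleSum (swap x y * σ) = cycleSum σ + 1 := by
  have hxy : x ≠ y := fun e => h (e ▸ Perm.SameCycle.refl _ _)
  have := cycleSum_cut hxy (sameCycle_join h)
  rw [swap_mul_self_mul] at this
  exact this.symm

theorem cycleSum_le_length (l : List (Perm (Fin n))) (hl : ∀ t ∈ l, t.IsSwap) :
    cycleSum l.prod ≤ l.length := by
  induction l with
  | nil => simp [cycleSum_one]
  | cons t l ih =>
    have h1 := ih fun s hs => hl s (List.mem_cons_of_mem _ hs)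
    obtain ⟨x, y, hxy, rfl⟩ := hl t List.mem_cons_self
    rw [List.prod_cons, List.length_cons, Nat.cast_succ]
    by_cases h : l.prod.SameCycle x y
    · have := cycleSum_cut hxy h
      linarith
    · rw [cycleSum_join h]
      linarith

theorem exists_list_cycleSum (m : ℕ) (σ : Perm (Fin n)) (hm : cycleSum σ ≤ m) :
    ∃ l : List (Perm (Fin n)), (∀ t ∈ l, t.IsSwap) ∧ l.prod = σ ∧ (l.length : ℝ) = cycleSum σ := by
  induction m generalizing σ with
  | zero =>
    by_cases h1 : σ = 1
    · exact ⟨[], by simp, h1.symm, by simp [h1, cycleSum_one]⟩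
    · obtain ⟨x, hx⟩ : ∃ x, σ x ≠ x := by
        by_contra! h
        exact h1 (Perm.ext h)
      have h2 := cycleSum_cut hx.symm (Perm.SameCycle.rfl.apply_right : σ.SameCycle x (σ x))
      have h3 := cycleSum_nonneg (swap x (σ x) * σ)
      rw [Nat.cast_zero] at hm
      linarith
  | succ m ih =>
    by_cases h1 : σ = 1
    · exact ⟨[], by simp, h1.symm, by simp [h1, cycleSum_one]⟩
    · obtain ⟨x, hx⟩ : ∃ x, σ x ≠ x := by
        by_contra! h
        exact h1 (Perm.ext h)
      have h2 := cycleSum_cut hx.symm (Perm.SameCycle.rfl.apply_right : σ.SameCycle x (σ x))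
      obtain ⟨l, hl, hprod, hlen⟩ := ih (swap x (σ x) * σ) (by push_cast at hm; linarith)
      refine ⟨swap x (σ x) :: l, ?_, ?_, ?_⟩
      · intro t ht
        rcases List.mem_cons.1 ht with rfl | ht
        · exact ⟨x, σ x, hx.symm, rfl⟩
        · exact hl t ht
      · rw [List.prod_cons, hprod, swap_mul_self_mul]
      · rw [List.length_cons, Nat.cast_succ, hlen, h2]

theorem absLength_eq_cycleSum (σ : Perm (Fin n)) : (absLength σ : ℝ) = cycleSum σ := by
  apply le_antisymm
  · obtain ⟨m, hm⟩ := exists_nat_ge (cycleSum σ)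
    obtain ⟨l, hl, hprod, hlen⟩ := exists_list_cycleSum m σ hm
    rw [← hlen]
    exact_mod_cast absLength_le_of_list l hl hprod
  · obtain ⟨l, hl, hlen, hprod⟩ := exists_swap_list σ
    rw [← hlen, ← hprod]
    exact cycleSum_le_length l hl

theorem absLength_cut {σ : Perm (Fin n)} {x y : Fin n} (hxy : x ≠ y) (h : σ.SameCycle x y) :
    absLength (swap x y * σ) + 1 = absLength σ := by
  have := cycleSum_cut hxy h
  rw [← absLength_eq_cycleSum, ← absLength_eq_cycleSum] at this
  exact_mod_cast this

theorem absLength_join {σ : Perm (Fin n)} {x y : Fin n} (h : ¬ σ.SameCycle x y) :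
    absLength (swap x y * σ) = absLength σ + 1 := by
  have := cycleSum_join h
  rw [← absLength_eq_cycleSum, ← absLength_eq_cycleSum] at this
  exact_mod_cast this

end Length

section Block

/-- The permutations that map the set `S` onto itself. -/
def blockSubgroup {V : Type*} (S : Finset V) : Subgroup (Perm V) where
  carrier := {σ | ∀ z, σ z ∈ S ↔ z ∈ S}
  mul_mem' := fun {a b} ha hb z => by rw [Perm.mul_apply, ha, hb]
  one_mem' := fun _ => Iff.rfl
  inv_mem' := fun {a} ha z => by
    rw [← ha, ← Perm.mul_apply, mul_inv_cancel, Perm.one_apply]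

theorem mem_blockSubgroup {V : Type*} {S : Finset V} {σ : Perm V} :
    σ ∈ blockSubgroup S ↔ ∀ z, σ z ∈ S ↔ z ∈ S := Iff.rfl

theorem iterate_mem_block {V : Type*} {S : Finset V} {σ : Perm V} (h : σ ∈ blockSubgroup S)
    (z : V) (j : ℕ) : σ^[j] z ∈ S ↔ z ∈ S := by
  induction j with
  | zero => rfl
  | succ j ih => rw [iterate_succ_apply', h, ih]

theorem mem_iff_of_sameCycle {V : Type*} [Finite V] {S : Finset V} {σ : Perm V}
    (h : σ ∈ blockSubgroup S) {x y : V} (hxy : σ.SameCycle x y) : x ∈ S ↔ y ∈ S := by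
  obtain ⟨j, -, rfl⟩ := exists_iterate_of_sameCycle hxy
  exact (iterate_mem_block h x j).symm

theorem swap_mem_blockSubgroup {V : Type*} [DecidableEq V] {S : Finset V} {x y : V} :
    swap x y ∈ blockSubgroup S ↔ (x ∈ S ↔ y ∈ S) := by
  constructor
  · intro h
    rw [← h x, swap_apply_left]
  · intro h z
    rcases eq_or_ne z x with rfl | hx
    · rw [swap_apply_left, h]
    · rcases eq_or_ne z y with rfl | hy
      · rw [swap_apply_right, h]
      · rw [swap_apply_of_ne_of_ne hx hy]

variable {n : ℕ} {S : Finset (Fin n)}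

/-- A transposition exchanging letters of the two blocks joins two cycles of a permutation that
preserves the blocks. -/
theorem absLength_cross_mul {σ t : Perm (Fin n)} (hσ : σ ∈ blockSubgroup S) (ht : t.IsSwap)
    (htS : t ∉ blockSubgroup S) : absLength (t * σ) = absLength σ + 1 := by
  obtain ⟨x, y, -, rfl⟩ := ht
  exact absLength_join fun h => htS (swap_mem_blockSubgroup.2 (mem_iff_of_sameCycle hσ h))

theorem absLength_mul_cross {σ t : Perm (Fin n)} (hσ : σ ∈ blockSubgroup S) (ht : t.IsSwap)
    (htS : t ∉ blockSubgroup S) : absLength (σ * t) = absLength σ + 1 := by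
  rw [← absLength_inv, mul_inv_rev, isSwap_inv ht,
    absLength_cross_mul (inv_mem hσ) ht htS, absLength_inv]

/-- A factorization of a block-preserving permutation that uses a transposition exchanging letters
of the two blocks has at least two superfluous factors. -/
theorem absLength_add_two_le (l : List (Perm (Fin n))) (hl : ∀ t ∈ l, t.IsSwap)
    (hcross : ∃ t ∈ l, t ∉ blockSubgroup S) (hprod : l.prod ∈ blockSubgroup S) :
    absLength l.prod + 2 ≤ l.length := by
  induction l with
  | nil => simp at hcross
  | cons t l ih =>
    have hl' : ∀ s ∈ l, s.IsSwap := fun s hs => hl s (List.mem_cons_of_mem _ hs)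
    have ht := hl t List.mem_cons_self
    rw [List.prod_cons] at hprod ⊢
    rw [List.length_cons]
    by_cases htS : t ∈ blockSubgroup S
    · have h1 : l.prod ∈ blockSubgroup S := by
        have := mul_mem (inv_mem htS) hprod
        rwa [inv_mul_cancel_left] at this
      obtain ⟨s, hs, hsS⟩ := hcross
      have hs' : s ∈ l := by
        rcases List.mem_cons.1 hs with rfl | h
        · exact absurd htS hsS
        · exact h
      have h2 := ih hl' ⟨s, hs', hsS⟩ h1
      have h3 := absLength_mul_le t l.prod
      rw [absLength_eq_one_iff.2 ht] at h3
      omega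
    · have h1 := absLength_cross_mul hprod ht htS
      have h2 : t * (t * l.prod) = l.prod := by
        nth_rewrite 1 [← isSwap_inv ht]
        exact inv_mul_cancel_left _ _
      rw [h2] at h1
      have h3 := absLength_le_of_list l hl' rfl
      omega

/-- The same for a factorization into two permutations that do not preserve the blocks. -/
theorem absLength_add_two_le_of_notMem {σ ρ : Perm (Fin n)} (hσ : σ ∈ blockSubgroup S)
    (hρ : ρ ∉ blockSubgroup S) : absLength σ + 2 ≤ absLength ρ + absLength (ρ⁻¹ * σ) := by
  obtain ⟨l, hl, hlen, hprod⟩ := exists_swap_list ρ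
  obtain ⟨m, hm, hmlen, hmprod⟩ := exists_swap_list (ρ⁻¹ * σ)
  have hp : (l ++ m).prod = σ := by
    rw [List.prod_append, hprod, hmprod, mul_inv_cancel_left]
  rw [← hlen, ← hmlen, ← List.length_append, ← hp]
  refine absLength_add_two_le (S := S) _ (fun t ht => (List.mem_append.1 ht).elim (hl t) (hm t))
    ?_ (hp ▸ hσ)
  by_contra! h
  exact hρ (hprod ▸ Subgroup.list_prod_mem _ fun t ht => h t (List.mem_append_left _ ht))

end Block

open scoped Classical in
theorem sum_swap_eq {V : Type*} [Fintype V] [DecidableEq V] (F : Perm V → ℝ) :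
    ∑ x, ∑ y, (if x ≠ y then F (swap x y) else 0) =
      2 * ∑ t : Perm V, if t.IsSwap then F t else 0 := by
  rw [← Fintype.sum_prod_type' (f := fun x y => if x ≠ y then F (swap x y) else 0), ← sum_filter,
    ← sum_filter, mul_sum, ← sum_fiberwise_of_maps_to' (t := univ.filter fun t : Perm V => t.IsSwap)
      (g := fun p : V × V => swap p.1 p.2) (f := F)]
  · refine sum_congr rfl fun t ht => ?_
    obtain ⟨a, b, hab, rfl⟩ := (mem_filter.1 ht).2
    have hfib : (univ.filter fun p : V × V => p.1 ≠ p.2).filter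
        (fun p => swap p.1 p.2 = swap a b) = {(a, b), (b, a)} := by
      ext ⟨x, y⟩
      simp only [mem_filter, mem_univ, true_and, mem_insert, mem_singleton, Prod.mk.injEq]
      constructor
      · rintro ⟨hxy, h⟩
        have h1 : swap a b x = y := by rw [← h, swap_apply_left]
        rcases eq_or_ne x a with rfl | hxa
        · rw [swap_apply_left] at h1
          exact Or.inl ⟨rfl, h1.symm⟩
        · rcases eq_or_ne x b with rfl | hxb
          · rw [swap_apply_right] at h1
            exact Or.inr ⟨rfl, h1.symm⟩
          · rw [swap_apply_of_ne_of_ne hxa hxb] at h1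
            exact absurd h1 hxy
      · rintro (⟨rfl, rfl⟩ | ⟨rfl, rfl⟩)
        · exact ⟨hab, rfl⟩
        · exact ⟨hab.symm, swap_comm _ _⟩
    rw [hfib, sum_const, card_pair (by simp [hab]), nsmul_eq_mul, Nat.cast_ofNat]
  · intro p hp
    exact mem_filter.2 ⟨mem_univ _, p.1, p.2, (mem_filter.1 hp).2, rfl⟩

section Words

variable {n : ℕ}

/-- The set of factorizations of `σ` into `k` transpositions. -/
def swapWords (k : ℕ) (σ : Perm (Fin n)) : Set (Fin k → Perm (Fin n)) :=
  {η | (∀ i, (η i).IsSwap) ∧ (List.ofFn η).prod = σ}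

/-- The factorizations in which some transposition does not preserve `S`. -/
def crossWords (S : Finset (Fin n)) (k : ℕ) (σ : Perm (Fin n)) : Set (Fin k → Perm (Fin n)) :=
  {η | η ∈ swapWords k σ ∧ ∃ i, η i ∉ blockSubgroup S}

theorem cons_mem_swapWords {k : ℕ} {σ t : Perm (Fin n)} {η : Fin k → Perm (Fin n)} :
    (Fin.cons t η : Fin (k + 1) → Perm (Fin n)) ∈ swapWords (k + 1) σ ↔
      t.IsSwap ∧ η ∈ swapWords k (t * σ) := by
  simp only [swapWords, Set.mem_ofPred_eq, Fin.forall_fin_succ, Fin.cons_zero, Fin.cons_succ,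
    List.ofFn_cons, List.prod_cons, and_assoc]
  refine and_congr_right fun ht => and_congr_right fun _ => ?_
  rw [← eq_inv_mul_iff_mul_eq, isSwap_inv ht]

theorem cons_mem_crossWords {S : Finset (Fin n)} {k : ℕ} {σ t : Perm (Fin n)}
    {η : Fin k → Perm (Fin n)} :
    (Fin.cons t η : Fin (k + 1) → Perm (Fin n)) ∈ crossWords S (k + 1) σ ↔
      t.IsSwap ∧ ((t ∉ blockSubgroup S ∧ η ∈ swapWords k (t * σ)) ∨
        (t ∈ blockSubgroup S ∧ η ∈ crossWords S k (t * σ))) := by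
  simp only [crossWords, Set.mem_ofPred_eq, cons_mem_swapWords, Fin.exists_fin_succ, Fin.cons_zero,
    Fin.cons_succ]
  by_cases ht : t ∈ blockSubgroup S <;> simp [ht, and_assoc]

open scoped Classical in
/-- The cardinality of a set of words, as a real number. -/
noncomputable def wordCount {k : ℕ} (A : Set (Fin k → Perm (Fin n))) : ℝ :=
  ∑ η, if η ∈ A then 1 else 0

theorem wordCount_eq_card {k : ℕ} (A : Set (Fin k → Perm (Fin n))) :
    wordCount A = Nat.card A := by
  classical
  rw [wordCount, sum_boole, Nat.card_eq_fintype_card, Fintype.card_subtype]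

theorem wordCount_empty {k : ℕ} {A : Set (Fin k → Perm (Fin n))} (h : ∀ η, η ∉ A) :
    wordCount A = 0 := by
  classical
  exact sum_eq_zero fun η _ => if_neg (h η)

theorem wordCount_succ {k : ℕ} (A : Set (Fin (k + 1) → Perm (Fin n))) :
    wordCount A = ∑ t, wordCount {η : Fin k → Perm (Fin n) | Fin.cons t η ∈ A} := by
  classical
  unfold wordCount
  rw [← (Fin.consEquiv fun _ : Fin (k + 1) => Perm (Fin n)).sum_comp, Fintype.sum_prod_type]
  rfl

theorem wordCount_swapWords_succ (k : ℕ) (σ : Perm (Fin n)) :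
    2 * wordCount (swapWords (k + 1) σ) =
      ∑ x, ∑ y, if x ≠ y then wordCount (swapWords k (swap x y * σ)) else 0 := by
  classical
  rw [sum_swap_eq fun t => wordCount (swapWords k (t * σ)), wordCount_succ]
  congr 1
  refine sum_congr rfl fun t _ => ?_
  split_ifs with h
  · congr 1
    ext η
    simp [cons_mem_swapWords, h]
  · exact wordCount_empty fun η hη => h (cons_mem_swapWords.1 hη).1

open scoped Classical in
theorem wordCount_crossWords_succ (S : Finset (Fin n)) (k : ℕ) (σ : Perm (Fin n)) :
    2 * wordCount (crossWords S (k + 1) σ) =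
      ∑ x, ∑ y, if x ≠ y then (if (x ∈ S ↔ y ∈ S) then wordCount (crossWords S k (swap x y * σ))
        else wordCount (swapWords k (swap x y * σ))) else 0 := by
  have h0 := sum_swap_eq fun t => if t ∈ blockSubgroup S then wordCount (crossWords S k (t * σ))
    else wordCount (swapWords k (t * σ))
  have h1 : ∀ x y : Fin n, (if swap x y ∈ blockSubgroup S then
      wordCount (crossWords S k (swap x y * σ)) else wordCount (swapWords k (swap x y * σ))) =
      if (x ∈ S ↔ y ∈ S) then wordCount (crossWords S k (swap x y * σ))
        else wordCount (swapWords k (swap x y * σ)) := fun x y => by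
    by_cases h : (x ∈ S ↔ y ∈ S) <;> simp [swap_mem_blockSubgroup, h]
  simp only [h1] at h0
  rw [h0, wordCount_succ]
  congr 1
  refine sum_congr rfl fun t _ => ?_
  split_ifs with h h1
  · congr 1
    ext η
    simp [cons_mem_crossWords, h, h1]
  · congr 1
    ext η
    simp [cons_mem_crossWords, h, h1]
  · exact wordCount_empty fun η hη => h (cons_mem_crossWords.1 hη).1

theorem absLength_le_of_mem_swapWords {k : ℕ} {σ : Perm (Fin n)} {η : Fin k → Perm (Fin n)}
    (h : η ∈ swapWords k σ) : absLength σ ≤ k := by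
  have := absLength_le_of_list (List.ofFn η) (List.forall_mem_ofFn_iff.2 h.1) h.2
  rwa [List.length_ofFn] at this

theorem absLength_add_two_le_of_mem_crossWords {S : Finset (Fin n)} {k : ℕ} {σ : Perm (Fin n)}
    (hσ : σ ∈ blockSubgroup S) {η : Fin k → Perm (Fin n)} (h : η ∈ crossWords S k σ) :
    absLength σ + 2 ≤ k := by
  obtain ⟨⟨h1, h2⟩, i, hi⟩ := h
  have := absLength_add_two_le (S := S) (List.ofFn η) (List.forall_mem_ofFn_iff.2 h1)
    ⟨η i, List.mem_ofFn.2 ⟨i, rfl⟩, hi⟩ (h2 ▸ hσ)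
  rwa [List.length_ofFn, h2] at this

/-- A sum over the second letters of the transpositions that cut the cycle through `x`. -/
theorem sum_sameCycle (σ : Perm (Fin n)) (x : Fin n)
    (F : Fin n → ℝ) (hF : ∀ y, y ≠ x → ¬ σ.SameCycle x y → F y = 0) :
    ∑ y, (if x ≠ y then F y else 0) = ∑ i ∈ Ioo 0 (cycleLen σ x), F (σ^[i] x) := by
  classical
  rw [← sum_filter]
  symm
  refine sum_bij_ne_zero (fun i _ _ => σ^[i] x) ?_ ?_ ?_ ?_
  · intro i hi _
    rw [mem_Ioo] at hi
    exact mem_filter.2 ⟨mem_univ _, (iterate_ne_self hi.1 hi.2).symm⟩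
  · intro i hi _ j hj _ h
    rw [mem_Ioo] at hi hj
    exact iterate_inj hi.2 hj.2 h
  · intro y hy hne
    have hxy := (mem_filter.1 hy).2
    have hs : σ.SameCycle x y := by
      by_contra h
      exact hne (hF y hxy.symm h)
    obtain ⟨i, h0, hi, hi'⟩ := exists_cut hxy hs
    exact ⟨i, mem_Ioo.2 ⟨h0, hi⟩, by rwa [hi'], hi'⟩
  · intro i _ _
    rfl

end Words

section Minimal

variable {n : ℕ}

/-- The `k`-th root of `treeCoeff k`. -/
noncomputable def rootCoeff (k : ℕ) : ℝ := treeCoeff k ^ (1 / (k : ℝ))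

theorem rootCoeff_pow {k : ℕ} (hk : 0 < k) : rootCoeff k ^ k = treeCoeff k := by
  rw [rootCoeff, one_div]
  exact Real.rpow_inv_natCast_pow (treeCoeff_pos hk).le hk.ne'

/-- The product over the cycles of `σ` of the tree coefficients of their lengths. -/
noncomputable def cycleWeight (σ : Perm (Fin n)) : ℝ := ∏ z, rootCoeff (cycleLen σ z)

theorem treeCoeff_cycleLen_ne_zero (σ : Perm (Fin n)) (x : Fin n) :
    treeCoeff (cycleLen σ x) ≠ 0 :=
  (treeCoeff_pos (cycleLen_pos σ x)).ne'

theorem cycleWeight_cut {σ : Perm (Fin n)} {x : Fin n} {i : ℕ} (hi : i ∈ Ioo 0 (cycleLen σ x)) :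
    cycleWeight (swap x (σ^[i] x) * σ) = cycleWeight σ / treeCoeff (cycleLen σ x) *
      (treeCoeff i * treeCoeff (cycleLen σ x - i)) := by
  rw [mem_Ioo] at hi
  have := prod_cycleLen_cut hi.1 hi.2 rootCoeff univ fun _ => mem_univ _
  rw [rootCoeff_pow (cycleLen_pos σ x), rootCoeff_pow hi.1, rootCoeff_pow (by omega)] at this
  have h0 := treeCoeff_cycleLen_ne_zero σ x
  rw [div_mul_eq_mul_div, eq_div_iff h0]
  exact this

theorem cycleWeight_join {σ : Perm (Fin n)} {x y : Fin n} (h : ¬ σ.SameCycle x y) :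
    cycleWeight (swap x y * σ) = cycleWeight σ *
      (treeCoeff (cycleLen σ x + cycleLen σ y) /
        (treeCoeff (cycleLen σ x) * treeCoeff (cycleLen σ y))) := by
  have := prod_cycleLen_join rootCoeff h univ fun _ => mem_univ _
  rw [rootCoeff_pow (cycleLen_pos σ x), rootCoeff_pow (cycleLen_pos σ y),
    rootCoeff_pow (by have := cycleLen_pos σ x; omega)] at this
  have h0 := treeCoeff_cycleLen_ne_zero σ x
  have h1 := treeCoeff_cycleLen_ne_zero σ y
  rw [← mul_div_assoc, eq_div_iff (mul_ne_zero h0 h1)]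
  exact this.symm

theorem sum_cycleWeight_cut (σ : Perm (Fin n)) (x : Fin n) :
    ∑ i ∈ Ioo 0 (cycleLen σ x), cycleWeight (swap x (σ^[i] x) * σ) =
      cycleWeight σ * (2 * (1 - 1 / (cycleLen σ x : ℝ))) := by
  rw [sum_congr rfl fun i hi => cycleWeight_cut hi, ← mul_sum,
    sum_treeCoeff_mul (cycleLen_pos σ x)]
  have h0 := treeCoeff_cycleLen_ne_zero σ x
  have h1 : (cycleLen σ x : ℝ) ≠ 0 := by exact_mod_cast (cycleLen_pos σ x).ne'
  field_simp

theorem absLength_cut_iterate {σ : Perm (Fin n)} {x : Fin n} {i : ℕ}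
    (hi : i ∈ Ioo 0 (cycleLen σ x)) :
    absLength (swap x (σ^[i] x) * σ) + 1 = absLength σ := by
  rw [mem_Ioo] at hi
  exact absLength_cut (iterate_ne_self hi.1 hi.2).symm (sameCycle_iterate σ x i)

/-- The number of minimal factorizations into transpositions. -/
theorem wordCount_swapWords (k : ℕ) (σ : Perm (Fin n)) (hk : absLength σ = k) :
    wordCount (swapWords k σ) = k.factorial * cycleWeight σ := by
  induction k generalizing σ with
  | zero =>
    obtain rfl := eq_one_of_absLength_eq_zero hk
    have hw : cycleWeight (1 : Perm (Fin n)) = 1 := prod_eq_one fun z _ => by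
      have : cycleLen (1 : Perm (Fin n)) z = 1 := minimalPeriod_id
      simp [this, rootCoeff, treeCoeff]
    rw [hw, wordCount_eq_card]
    have : swapWords 0 (1 : Perm (Fin n)) = Set.univ := by
      ext η
      simp [swapWords]
    rw [this]
    simp
  | succ k ih =>
    have h1 : ∀ x, ∑ y, (if x ≠ y then wordCount (swapWords k (swap x y * σ)) else 0) =
        k.factorial * (cycleWeight σ * (2 * (1 - 1 / (cycleLen σ x : ℝ)))) := by
      intro x
      rw [sum_sameCycle σ x (fun y => wordCount (swapWords k (swap x y * σ))),
        ← sum_cycleWeight_cut, mul_sum]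
      · refine sum_congr rfl fun i hi => ih _ ?_
        have := absLength_cut_iterate hi
        omega
      · intro y _ h
        refine wordCount_empty fun η hη => ?_
        have := absLength_le_of_mem_swapWords hη
        rw [absLength_join h] at this
        omega
    have h2 := wordCount_swapWords_succ k σ
    rw [sum_congr rfl fun x _ => h1 x, ← mul_sum, ← mul_sum, ← mul_sum] at h2
    have h3 : ∑ z, (1 - 1 / (cycleLen σ z : ℝ)) = k + 1 := by
      have := absLength_eq_cycleSum σ
      rw [hk] at this
      rw [← cycleSum, ← this, Nat.cast_succ]
    rw [h3] at h2
    rw [Nat.factorial_succ]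
    push_cast
    linarith

end Minimal

section Cross

variable {n : ℕ}

/-- The weight of a pair of cycles of lengths `a` and `b`. -/
noncomputable def pairCoeff (a b : ℕ) : ℝ := a * b / (a + b)

theorem pairCoeff_comm (a b : ℕ) : pairCoeff a b = pairCoeff b a := by
  rw [pairCoeff, pairCoeff, mul_comm, add_comm]

/-- The sum of `pairCoeff` over the pairs of letters of different blocks. -/
noncomputable def pairWeight (S : Finset (Fin n)) (σ : Perm (Fin n)) : ℝ :=
  ∑ u ∈ S, ∑ v ∈ Sᶜ, pairCoeff (cycleLen σ u) (cycleLen σ v)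

theorem pairWeight_compl (S : Finset (Fin n)) (σ : Perm (Fin n)) :
    pairWeight Sᶜ σ = pairWeight S σ := by
  rw [pairWeight, pairWeight, compl_compl, sum_comm]
  exact sum_congr rfl fun u _ => sum_congr rfl fun v _ => pairCoeff_comm _ _

theorem blockSubgroup_compl (S : Finset (Fin n)) : blockSubgroup Sᶜ = blockSubgroup S := by
  ext σ
  simp only [mem_blockSubgroup, mem_compl, not_iff_not]

/-- The contribution of the cuts of a cycle of length `a` to the pairs with a cycle of length `b`. -/
noncomputable def cutCoeff (a b : ℕ) : ℝ :=
  ∑ i ∈ Ioo 0 a, treeCoeff i * treeCoeff (a - i) * (i * pairCoeff i b)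

theorem sum_treeCoeff_mul_cut {a : ℕ} (ha : 0 < a) (b : ℕ) :
    ∑ i ∈ Ioo 0 a, treeCoeff i * treeCoeff (a - i) *
      (i * pairCoeff i b + (a - i : ℕ) * pairCoeff (a - i) b - a * pairCoeff a b) =
      2 * cutCoeff a b - 2 * (a - 1) * treeCoeff a * pairCoeff a b := by
  have h1 : ∑ i ∈ Ioo 0 a, treeCoeff i * treeCoeff (a - i) *
      ((a - i : ℕ) * pairCoeff (a - i) b) = cutCoeff a b := by
    refine sum_bij' (fun i _ => a - i) (fun i _ => a - i) ?_ ?_ ?_ ?_ ?_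
    · intro i hi; rw [mem_Ioo] at *; omega
    · intro i hi; rw [mem_Ioo] at *; omega
    · intro i hi; rw [mem_Ioo] at *; omega
    · intro i hi; rw [mem_Ioo] at *; omega
    · intro i hi
      rw [Nat.sub_sub_self (mem_Ioo.1 hi).2.le]
      ring
  have h2 := sum_treeCoeff_mul ha
  have h0 : (a : ℝ) ≠ 0 := by exact_mod_cast ha.ne'
  simp only [mul_sub, mul_add, sum_sub_distrib, sum_add_distrib]
  rw [← sum_mul, h1, h2, ← cutCoeff]
  field_simp
  ring

variable {S : Finset (Fin n)} {σ : Perm (Fin n)}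

theorem pairWeight_cut (hσ : σ ∈ blockSubgroup S) {x : Fin n} (hx : x ∈ S) {i : ℕ}
    (hi : i ∈ Ioo 0 (cycleLen σ x)) :
    pairWeight S (swap x (σ^[i] x) * σ) = pairWeight S σ + ∑ v ∈ Sᶜ,
      (i * pairCoeff i (cycleLen σ v) +
        (cycleLen σ x - i : ℕ) * pairCoeff (cycleLen σ x - i) (cycleLen σ v) -
        cycleLen σ x * pairCoeff (cycleLen σ x) (cycleLen σ v)) := by
  rw [mem_Ioo] at hi
  rw [pairWeight, pairWeight, sum_comm, sum_comm (s := S), ← sum_add_distrib]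
  refine sum_congr rfl fun v hv => ?_
  rw [mem_compl] at hv
  have hvx : ¬ σ.SameCycle v x := fun h => hv ((mem_iff_of_sameCycle hσ h).2 hx)
  rw [cycleLen_swap_mul_of_not_sameCycle hvx
    fun h => hvx (h.trans (sameCycle_iterate σ x i).symm)]
  have := sum_cycleLen_cut hi.1 hi.2 (fun k => pairCoeff k (cycleLen σ v)) S
    fun j => (iterate_mem_block hσ x j).2 hx
  simp only [nsmul_eq_mul] at this
  linarith

theorem sum_cut_weight (hσ : σ ∈ blockSubgroup S) {x : Fin n} (hx : x ∈ S) :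
    ∑ i ∈ Ioo 0 (cycleLen σ x), cycleWeight (swap x (σ^[i] x) * σ) *
      pairWeight S (swap x (σ^[i] x) * σ) =
    cycleWeight σ * (2 * (1 - 1 / (cycleLen σ x : ℝ)) * pairWeight S σ +
      ∑ v ∈ Sᶜ, (2 * cutCoeff (cycleLen σ x) (cycleLen σ v) / treeCoeff (cycleLen σ x) -
        2 * (cycleLen σ x - 1) * pairCoeff (cycleLen σ x) (cycleLen σ v))) := by
  have h0 := treeCoeff_cycleLen_ne_zero σ x
  rw [sum_congr rfl fun i hi => by rw [pairWeight_cut hσ hx hi, mul_add], sum_add_distrib,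
    ← sum_mul, sum_cycleWeight_cut, mul_add, mul_assoc, add_right_inj,
    sum_congr rfl fun i hi => by rw [cycleWeight_cut hi, mul_assoc, mul_sum], ← mul_sum, sum_comm,
    sum_congr rfl fun v _ => sum_treeCoeff_mul_cut (cycleLen_pos σ x) (cycleLen σ v),
    div_mul_eq_mul_div, mul_div_assoc, sum_div]
  congr 1
  refine sum_congr rfl fun v _ => ?_
  field_simp

/-- The contribution of a pair of letters to the join-cut recursion. -/
noncomputable def joinCutCoeff (a b : ℕ) : ℝ :=
  2 * cutCoeff a b / treeCoeff a - 2 * (a - 1) * pairCoeff a b +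
    treeCoeff (a + b) / (treeCoeff a * treeCoeff b)

theorem joinCutCoeff_add {a b : ℕ} (ha : 0 < a) (hb : 0 < b) :
    joinCutCoeff a b + joinCutCoeff b a = 4 * pairCoeff a b := by
  have h := treeCoeff_join_cut ha hb
  have ha0 := (treeCoeff_pos ha).ne'
  have hb0 := (treeCoeff_pos hb).ne'
  have h' : ((a : ℝ) + b) * pairCoeff a b * (treeCoeff a * treeCoeff b) =
    treeCoeff b * cutCoeff a b + treeCoeff a * cutCoeff b a + treeCoeff (a + b) := h
  rw [joinCutCoeff, joinCutCoeff, pairCoeff_comm b a, add_comm b a]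
  field_simp
  linear_combination (-2 : ℝ) * h'

open scoped Classical in
theorem sum_join_cut (hσ : σ ∈ blockSubgroup S) {m : ℕ} (hm : absLength σ = m)
    (ih : ∀ τ ∈ blockSubgroup S, absLength τ + 1 = m →
      wordCount (crossWords S (m + 1) τ) = (m + 1).factorial * (cycleWeight τ * pairWeight S τ))
    {x : Fin n} (hx : x ∈ S) :
    ∑ y, (if x ≠ y then (if (x ∈ S ↔ y ∈ S) then
        wordCount (crossWords S (m + 1) (swap x y * σ))
        else wordCount (swapWords (m + 1) (swap x y * σ))) else 0) =
      (m + 1).factorial * (cycleWeight σ * (2 * (1 - 1 / (cycleLen σ x : ℝ)) * pairWeight S σ +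
        ∑ v ∈ Sᶜ, joinCutCoeff (cycleLen σ x) (cycleLen σ v))) := by
  have hsplit : ∀ y, (if x ≠ y then (if (x ∈ S ↔ y ∈ S) then
        wordCount (crossWords S (m + 1) (swap x y * σ))
        else wordCount (swapWords (m + 1) (swap x y * σ))) else 0) =
      (if x ≠ y then (if y ∈ S then wordCount (crossWords S (m + 1) (swap x y * σ)) else 0)
        else 0) +
      if y ∈ Sᶜ then wordCount (swapWords (m + 1) (swap x y * σ)) else 0 := by
    intro y
    by_cases hy : y ∈ S
    · simp [hx, hy]
    · have hxy : x ≠ y := fun e => hy (e ▸ hx)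
      simp [hx, hy, hxy]
  rw [sum_congr rfl fun y _ => hsplit y, sum_add_distrib,
    sum_sameCycle σ x fun y => if y ∈ S then wordCount (crossWords S (m + 1) (swap x y * σ)) else 0]
  · have h1 : ∀ i ∈ Ioo 0 (cycleLen σ x), (if σ^[i] x ∈ S then
        wordCount (crossWords S (m + 1) (swap x (σ^[i] x) * σ)) else 0) =
        (m + 1).factorial * (cycleWeight (swap x (σ^[i] x) * σ) *
          pairWeight S (swap x (σ^[i] x) * σ)) := by
      intro i hi
      have hmem : σ^[i] x ∈ S := (iterate_mem_block hσ x i).2 hx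
      rw [if_pos hmem]
      refine ih _ (mul_mem (swap_mem_blockSubgroup.2 ⟨fun _ => hmem, fun _ => hx⟩) hσ) ?_
      rw [absLength_cut_iterate hi, hm]
    have h2 : ∀ v ∈ Sᶜ, wordCount (swapWords (m + 1) (swap x v * σ)) =
        (m + 1).factorial * (cycleWeight σ * (treeCoeff (cycleLen σ x + cycleLen σ v) /
          (treeCoeff (cycleLen σ x) * treeCoeff (cycleLen σ v)))) := by
      intro v hv
      rw [mem_compl] at hv
      have hxv : ¬ σ.SameCycle x v := fun h => hv ((mem_iff_of_sameCycle hσ h).1 hx)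
      rw [wordCount_swapWords _ _ (by rw [absLength_join hxv, hm]), cycleWeight_join hxv]
    rw [sum_congr rfl h1, ← mul_sum, sum_cut_weight hσ hx, ← sum_filter, filter_mem_eq_inter,
      univ_inter, sum_congr rfl h2, ← mul_sum, ← mul_sum, ← mul_add, ← mul_add, add_assoc,
      ← sum_add_distrib]
    rfl
  · intro y _ h
    split_ifs with hy
    · refine wordCount_empty fun η hη => ?_
      have := absLength_add_two_le_of_mem_crossWords
        (mul_mem (swap_mem_blockSubgroup.2 ⟨fun _ => hy, fun _ => hx⟩) hσ) hη
      rw [absLength_join h] at this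
      omega
    · rfl

/-- The number of factorizations of a block-preserving permutation with two superfluous
transpositions, some of them exchanging letters of the two blocks. -/
theorem wordCount_crossWords (m : ℕ) (σ : Perm (Fin n)) (hσ : σ ∈ blockSubgroup S)
    (hm : absLength σ = m) :
    wordCount (crossWords S (m + 2) σ) =
      (m + 2).factorial * (cycleWeight σ * pairWeight S σ) := by
  classical
  induction m using Nat.strong_induction_on generalizing σ with
  | _ m IH =>
  have ih : ∀ τ ∈ blockSubgroup S, absLength τ + 1 = m →
      wordCount (crossWords S (m + 1) τ) =
        (m + 1).factorial * (cycleWeight τ * pairWeight S τ) := by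
    intro τ hτ hlen
    obtain ⟨k, rfl⟩ : ∃ k, m = k + 1 := ⟨m - 1, by omega⟩
    exact IH k (by omega) τ hτ (by omega)
  have hcompl : ∀ k τ, crossWords Sᶜ k τ = crossWords S k τ := fun k τ => by
    rw [crossWords, crossWords, blockSubgroup_compl]
  have hin : ∀ x ∈ S, _ := fun x hx => sum_join_cut hσ hm ih hx
  have hout : ∀ x ∈ Sᶜ, _ := fun x hx => sum_join_cut (S := Sᶜ) (by rwa [blockSubgroup_compl]) hm
    (fun τ hτ hlen => by
      rw [hcompl, pairWeight_compl]
      exact ih τ (by rwa [blockSubgroup_compl] at hτ) hlen) hx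
  simp only [hcompl, pairWeight_compl, compl_compl, mem_compl, not_iff_not] at hout
  have key := wordCount_crossWords_succ S (m + 1) σ
  rw [← sum_add_sum_compl S, sum_congr rfl hin,
    sum_congr rfl fun x hx => hout x (mem_compl.1 hx), ← mul_sum, ← mul_sum, ← mul_sum, ← mul_sum,
    ← mul_add, ← mul_add, sum_add_distrib, sum_add_distrib, add_add_add_comm,
    sum_add_sum_compl S (fun z => 2 * (1 - 1 / (cycleLen σ z : ℝ)) * pairWeight S σ), ← sum_mul,
    ← mul_sum, ← cycleSum, ← absLength_eq_cycleSum, hm,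
    sum_comm (s := Sᶜ), ← sum_add_distrib] at key
  have h2 : ∑ u ∈ S, (∑ v ∈ Sᶜ, joinCutCoeff (cycleLen σ u) (cycleLen σ v) +
      ∑ v ∈ Sᶜ, joinCutCoeff (cycleLen σ v) (cycleLen σ u)) = 4 * pairWeight S σ := by
    rw [pairWeight, mul_sum]
    refine sum_congr rfl fun u _ => ?_
    rw [← sum_add_distrib, mul_sum]
    exact sum_congr rfl fun v _ => joinCutCoeff_add (cycleLen_pos σ u) (cycleLen_pos σ v)
  rw [h2] at key
  rw [Nat.factorial_succ (m + 1)]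
  push_cast
  linarith

end Cross

section Alpha

open scoped Fin.NatCast

theorem finRotate_iterate (n j : ℕ) (i : Fin (n + 1)) :
    (finRotate (n + 1))^[j] i = i + (j : Fin (n + 1)) := by
  induction j with
  | zero => simp
  | succ j ih =>
    rw [Function.iterate_succ_apply', ih, finRotate_apply, Nat.cast_succ, add_assoc]

theorem cycleLen_finRotate {n : ℕ} (i : Fin n) : cycleLen (finRotate n) i = n := by
  obtain ⟨m, rfl⟩ : ∃ m, n = m + 1 := ⟨n - 1, by have := i.pos; omega⟩
  refine cycleLen_eq (Nat.succ_pos m) ?_ fun j h0 hj => ?_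
  · rw [finRotate_iterate, Fin.natCast_self, add_zero]
  · rw [finRotate_iterate, Ne, add_eq_left, Fin.natCast_eq_zero]
    exact Nat.not_dvd_of_pos_of_lt h0 hj

theorem exists_iterate_finRotate {n : ℕ} (i j : Fin n) : ∃ k, (finRotate n)^[k] i = j := by
  obtain ⟨m, rfl⟩ : ∃ m, n = m + 1 := ⟨n - 1, by have := i.pos; omega⟩
  refine ⟨(j - i).val, ?_⟩
  rw [finRotate_iterate, Fin.cast_val_eq_self]
  abel

variable {p q : ℕ}

theorem alpha_castAdd (i : Fin p) : alpha p q (Fin.castAdd q i) = Fin.castAdd q (finRotate p i) := by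
  simp [alpha]

theorem alpha_natAdd (j : Fin q) : alpha p q (Fin.natAdd p j) = Fin.natAdd p (finRotate q j) := by
  simp [alpha]

theorem alpha_iterate_castAdd (i : Fin p) (k : ℕ) :
    (alpha p q)^[k] (Fin.castAdd q i) = Fin.castAdd q ((finRotate p)^[k] i) := by
  induction k with
  | zero => rfl
  | succ k ih => rw [Function.iterate_succ_apply', ih, alpha_castAdd, Function.iterate_succ_apply']

theorem alpha_iterate_natAdd (j : Fin q) (k : ℕ) :
    (alpha p q)^[k] (Fin.natAdd p j) = Fin.natAdd p ((finRotate q)^[k] j) := by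
  induction k with
  | zero => rfl
  | succ k ih => rw [Function.iterate_succ_apply', ih, alpha_natAdd, Function.iterate_succ_apply']

theorem cycleLen_alpha_castAdd (i : Fin p) : cycleLen (alpha p q) (Fin.castAdd q i) = p := by
  conv_rhs => rw [← cycleLen_finRotate i]
  refine Function.minimalPeriod_eq_minimalPeriod_iff.2 fun k => ?_
  rw [Function.IsPeriodicPt, Function.IsPeriodicPt, Function.IsFixedPt, Function.IsFixedPt,
    alpha_iterate_castAdd, (Fin.castAdd_injective p q).eq_iff]

theorem cycleLen_alpha_natAdd (j : Fin q) : cycleLen (alpha p q) (Fin.natAdd p j) = q := by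
  conv_rhs => rw [← cycleLen_finRotate j]
  refine Function.minimalPeriod_eq_minimalPeriod_iff.2 fun k => ?_
  rw [Function.IsPeriodicPt, Function.IsPeriodicPt, Function.IsFixedPt, Function.IsFixedPt,
    alpha_iterate_natAdd, (Fin.natAdd_injective q p).eq_iff]

/-- The block of the first `p` letters. -/
def firstBlock (p q : ℕ) : Finset (Fin (p + q)) := univ.map (Fin.castAddEmb q)

theorem castAdd_mem (i : Fin p) : Fin.castAdd q i ∈ firstBlock p q :=
  mem_map.2 ⟨i, mem_univ _, rfl⟩

theorem natAdd_notMem (j : Fin q) : Fin.natAdd p j ∉ firstBlock p q := by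
  intro h
  obtain ⟨i, -, hi⟩ := mem_map.1 h
  have := congrArg Fin.val hi
  simp only [Fin.castAddEmb_apply, Fin.val_castAdd, Fin.val_natAdd] at this
  omega

theorem exists_castAdd_of_mem {z : Fin (p + q)} (h : z ∈ firstBlock p q) :
    ∃ i, Fin.castAdd q i = z := by
  obtain ⟨i, -, hi⟩ := mem_map.1 h
  exact ⟨i, hi⟩

theorem exists_natAdd_of_notMem {z : Fin (p + q)} (h : z ∉ firstBlock p q) :
    ∃ j, Fin.natAdd p j = z := by
  induction z using Fin.addCases with
  | left i => exact absurd (castAdd_mem i) h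
  | right j => exact ⟨j, rfl⟩

theorem alpha_mem_blockSubgroup : alpha p q ∈ blockSubgroup (firstBlock p q) := by
  intro z
  induction z using Fin.addCases with
  | left i => simp only [alpha_castAdd, castAdd_mem]
  | right j => simp only [alpha_natAdd, natAdd_notMem]

theorem sameCycle_alpha {x y : Fin (p + q)} (h : x ∈ firstBlock p q ↔ y ∈ firstBlock p q) :
    (alpha p q).SameCycle x y := by
  by_cases hx : x ∈ firstBlock p q
  · obtain ⟨i, rfl⟩ := exists_castAdd_of_mem hx
    obtain ⟨j, rfl⟩ := exists_castAdd_of_mem (h.1 hx)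
    obtain ⟨k, rfl⟩ := exists_iterate_finRotate i j
    rw [← alpha_iterate_castAdd]
    exact sameCycle_iterate _ _ _
  · obtain ⟨i, rfl⟩ := exists_natAdd_of_notMem hx
    obtain ⟨j, rfl⟩ := exists_natAdd_of_notMem fun hy => hx (h.2 hy)
    obtain ⟨k, rfl⟩ := exists_iterate_finRotate i j
    rw [← alpha_iterate_natAdd]
    exact sameCycle_iterate _ _ _

theorem connected_iff {π : Perm (Fin (p + q))} :
    Connected π ↔ π ∉ blockSubgroup (firstBlock p q) := by
  constructor
  · rintro ⟨i, j, h⟩ hπ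
    exact natAdd_notMem j ((mem_iff_of_sameCycle hπ h).1 (castAdd_mem i))
  · intro h
    rw [mem_blockSubgroup] at h
    push Not at h
    obtain ⟨z, ⟨h1, h2⟩ | ⟨h1, h2⟩⟩ := h
    · obtain ⟨i, hi⟩ := exists_castAdd_of_mem h1
      obtain ⟨j, hj⟩ := exists_natAdd_of_notMem h2
      exact ⟨i, j, by rw [hi, hj]; exact Perm.SameCycle.rfl.apply_left⟩
    · obtain ⟨i, hi⟩ := exists_castAdd_of_mem h2
      obtain ⟨j, hj⟩ := exists_natAdd_of_notMem h1
      exact ⟨i, j, by rw [hi, hj]; exact Perm.SameCycle.rfl.apply_right⟩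

theorem absLength_alpha (hp : 0 < p) (hq : 0 < q) : absLength (alpha p q) + 2 = p + q := by
  have h := absLength_eq_cycleSum (alpha p q)
  simp only [cycleSum, Fin.sum_univ_add, cycleLen_alpha_castAdd, cycleLen_alpha_natAdd, sum_const,
    card_univ, Fintype.card_fin, nsmul_one_sub_inv hp, nsmul_one_sub_inv hq] at h
  have : ((absLength (alpha p q) + 2 : ℕ) : ℝ) = ((p + q : ℕ) : ℝ) := by
    push_cast
    linarith
  exact_mod_cast this

theorem cycleWeight_alpha (hp : 0 < p) (hq : 0 < q) :
    cycleWeight (alpha p q) = treeCoeff p * treeCoeff q := by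
  simp only [cycleWeight, Fin.prod_univ_add, cycleLen_alpha_castAdd, cycleLen_alpha_natAdd,
    prod_const, card_univ, Fintype.card_fin, rootCoeff_pow hp, rootCoeff_pow hq]

theorem pairWeight_alpha :
    pairWeight (firstBlock p q) (alpha p q) = p * q * pairCoeff p q := by
  have h1 : ∀ u ∈ firstBlock p q, ∀ v ∈ (firstBlock p q)ᶜ,
      pairCoeff (cycleLen (alpha p q) u) (cycleLen (alpha p q) v) = pairCoeff p q := by
    intro u hu v hv
    obtain ⟨i, rfl⟩ := exists_castAdd_of_mem hu
    obtain ⟨j, rfl⟩ := exists_natAdd_of_notMem (mem_compl.1 hv)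
    rw [cycleLen_alpha_castAdd, cycleLen_alpha_natAdd]
  rw [pairWeight, sum_congr rfl fun u hu => sum_congr rfl fun v hv => h1 u hu v hv]
  simp [card_compl, firstBlock, mul_assoc]

theorem card_crossWords_alpha (hp : 0 < p) (hq : 0 < q) :
    (Nat.card (crossWords (firstBlock p q) (p + q) (alpha p q)) : ℝ) =
      (p * q : ℝ) / (p + q) * (p + q).choose q * (p : ℝ) ^ p * (q : ℝ) ^ q := by
  have h := wordCount_crossWords (absLength (alpha p q)) (alpha p q)
    alpha_mem_blockSubgroup rfl
  rw [absLength_alpha hp hq, wordCount_eq_card, cycleWeight_alpha hp hq, pairWeight_alpha] at h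
  have h1 := mul_treeCoeff hp
  have h2 := mul_treeCoeff hq
  have h3 : (p : ℝ) ≠ 0 := by positivity
  have h4 : (q : ℝ) ≠ 0 := by positivity
  rw [h, Nat.cast_choose ℝ (by omega : q ≤ p + q), Nat.add_sub_cancel, pairCoeff]
  have h5 : ((p + q).factorial : ℝ) * (treeCoeff p * treeCoeff q * (p * q * (p * q / (p + q)))) =
      (p + q).factorial * ((p * treeCoeff p) * (q * treeCoeff q) * (p * q / (p + q))) := by ring
  rw [h5, h1, h2]
  field_simp

theorem swap_notMem_blockSubgroup (i : Fin p) (j : Fin q) :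
    swap (Fin.castAdd q i) (Fin.natAdd p j) ∉ blockSubgroup (firstBlock p q) := fun h =>
  natAdd_notMem j ((swap_mem_blockSubgroup.1 h).1 (castAdd_mem i))

theorem minTransFact_eq (hp : 0 < p) (hq : 0 < q) :
    MinTransFact p q = crossWords (firstBlock p q) (p + q) (alpha p q) := by
  ext η
  simp only [MinTransFact, crossWords, swapWords, Set.mem_ofPred_eq, and_assoc]
  refine and_congr_right fun hswap => and_congr_right fun hprod => ?_
  constructor
  · intro htop
    by_contra! h
    have hle : Subgroup.closure (Set.range η) ≤ blockSubgroup (firstBlock p q) := by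
      rw [Subgroup.closure_le]
      rintro _ ⟨i, rfl⟩
      exact h i
    rw [htop] at hle
    exact swap_notMem_blockSubgroup (⟨0, hp⟩ : Fin p) (⟨0, hq⟩ : Fin q) (hle (Subgroup.mem_top _))
  · rintro ⟨i, hi⟩
    set H := Subgroup.closure (Set.range η) with hH
    have hmem : ∀ k, η k ∈ H := fun k => Subgroup.subset_closure ⟨k, rfl⟩
    have halpha : alpha p q ∈ H := by
      rw [← hprod]
      refine Subgroup.list_prod_mem _ fun t ht => ?_
      obtain ⟨k, rfl⟩ := List.mem_ofFn.1 ht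
      exact hmem k
    have hblock : ∀ x y, (x ∈ firstBlock p q ↔ y ∈ firstBlock p q) → ∃ g ∈ H, g x = y := by
      intro x y h
      obtain ⟨k, hk⟩ := sameCycle_alpha h
      exact ⟨alpha p q ^ k, zpow_mem halpha k, hk⟩
    obtain ⟨a, b, hab, hη⟩ := hswap i
    have hcross : ∃ a b, a ∈ firstBlock p q ∧ b ∉ firstBlock p q ∧ η i = swap a b := by
      rw [hη, swap_mem_blockSubgroup] at hi
      by_cases ha : a ∈ firstBlock p q
      · exact ⟨a, b, ha, fun hb => hi ⟨fun _ => hb, fun _ => ha⟩, hη⟩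
      · exact ⟨b, a, by tauto, ha, by rw [hη, swap_comm]⟩
    obtain ⟨a, b, ha, hb, hη⟩ := hcross
    have hall : ∀ z, ∃ g ∈ H, g a = z := by
      intro z
      by_cases hz : z ∈ firstBlock p q
      · exact hblock a z ⟨fun _ => hz, fun _ => ha⟩
      · obtain ⟨g, hg, hgz⟩ := hblock b z ⟨fun h => absurd h hb, fun h => absurd h hz⟩
        refine ⟨g * η i, mul_mem hg (hmem i), ?_⟩
        rw [Perm.mul_apply, hη, swap_apply_left, hgz]
    have : MulAction.IsPretransitive H (Fin (p + q)) := by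
      refine ⟨fun x y => ?_⟩
      obtain ⟨g, hg, rfl⟩ := hall x
      obtain ⟨g', hg', rfl⟩ := hall y
      refine ⟨⟨g' * g⁻¹, mul_mem hg' (inv_mem hg)⟩, ?_⟩
      change (g' * g⁻¹) (g a) = g' a
      rw [← Perm.mul_apply, inv_mul_cancel_right]
    exact closure_of_isSwap_of_isPretransitive fun σ ⟨k, hk⟩ => hk ▸ hswap k

end Alpha

section Poset

variable {p q : ℕ}

theorem isSwap_mul_self {n : ℕ} {t : Perm (Fin n)} (ht : t.IsSwap) : t * t = 1 := by
  nth_rewrite 1 [← isSwap_inv ht]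
  exact inv_mul_cancel t

theorem exists_swap_step {n : ℕ} {ρ : Perm (Fin n)} (h : 0 < absLength ρ) :
    ∃ t : Perm (Fin n), t.IsSwap ∧ absLength (t⁻¹ * ρ) + 1 = absLength ρ := by
  obtain ⟨l, hl, hlen, hprod⟩ := exists_swap_list ρ
  cases l with
  | nil => simp only [List.length_nil] at hlen; omega
  | cons t l =>
    have ht := hl t List.mem_cons_self
    refine ⟨t, ht, ?_⟩
    rw [List.prod_cons] at hprod
    have h1 : t⁻¹ * ρ = l.prod := by rw [← hprod, inv_mul_cancel_left]
    have h2 : absLength (t⁻¹ * ρ) ≤ l.length :=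
      absLength_le_of_list l (fun s hs => hl s (List.mem_cons_of_mem _ hs)) h1.symm
    have h3 := absLength_mul_le t (t⁻¹ * ρ)
    rw [mul_inv_cancel_left, absLength_eq_one_iff.2 ht] at h3
    rw [List.length_cons] at hlen
    omega

theorem absLength_le_add {n : ℕ} (π σ : Perm (Fin n)) :
    absLength σ ≤ absLength π + absLength (π⁻¹ * σ) := by
  have := absLength_mul_le π (π⁻¹ * σ)
  rwa [mul_inv_cancel_left] at this

theorem absLength_inv_mul_le {n : ℕ} (π σ ρ : Perm (Fin n)) :
    absLength (π⁻¹ * ρ) ≤ absLength (π⁻¹ * σ) + absLength (σ⁻¹ * ρ) := by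
  have := absLength_mul_le (π⁻¹ * σ) (σ⁻¹ * ρ)
  rwa [mul_assoc, mul_inv_cancel_left] at this

namespace MarkedNC

theorem absLength_of_mem (x : MarkedNC p q) (h : x.perm ∈ blockSubgroup (firstBlock p q)) :
    absLength (alpha p q) = absLength x.perm + absLength (x.perm⁻¹ * alpha p q) :=
  x.le_of_disconnected fun hc => connected_iff.1 hc h

theorem absLength_of_notMem (x : MarkedNC p q) (h : x.perm ∉ blockSubgroup (firstBlock p q)) :
    absLength (alpha p q) + 2 = absLength x.perm + absLength (x.perm⁻¹ * alpha p q) :=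
  x.length_of_connected (connected_iff.2 h)

theorem mem_of_mark (x : MarkedNC p q) (h : x.mark = 1) :
    x.perm ∈ blockSubgroup (firstBlock p q) :=
  not_not.1 fun hn => x.disconnected_of_mark h (connected_iff.2 hn)

theorem mark_eq_zero_of_notMem (x : MarkedNC p q)
    (h : x.perm ∉ blockSubgroup (firstBlock p q)) : x.mark = 0 := by
  by_contra h0
  exact h (x.mem_of_mark (by omega))

/-- A disconnected permutation below `alpha p q`, with a mark. -/
def ofMem (π : Perm (Fin (p + q))) (hπ : π ∈ blockSubgroup (firstBlock p q))
    (h : absLength π + absLength (π⁻¹ * alpha p q) ≤ absLength (alpha p q)) (z : Fin 2) :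
    MarkedNC p q where
  perm := π
  mark := z
  le_of_disconnected _ := (absLength_le_add π (alpha p q)).antisymm h
  length_of_connected hc := absurd hπ (connected_iff.1 hc)
  disconnected_of_mark _ hc := connected_iff.1 hc hπ

/-- A connected annular noncrossing permutation. -/
def ofNotMem (π : Perm (Fin (p + q))) (hπ : π ∉ blockSubgroup (firstBlock p q))
    (h : absLength π + absLength (π⁻¹ * alpha p q) ≤ absLength (alpha p q) + 2) :
    MarkedNC p q where
  perm := π
  mark := 0
  le_of_disconnected hc := absurd (connected_iff.2 hπ) hc
  length_of_connected _ :=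
    (absLength_add_two_le_of_notMem alpha_mem_blockSubgroup hπ).antisymm h
  disconnected_of_mark h0 := absurd h0 (by decide)

theorem rank_lt_of_lt {x y : MarkedNC p q} (h : x < y) : x.rank < y.rank :=
  (rank_lt_or_eq_of_reflTransGen h.le).resolve_right h.ne

theorem BasicLE.le {x y : MarkedNC p q} (h : x.BasicLE y) : x ≤ y := Relation.ReflTransGen.single h

theorem BasicLE.absLength_eq {x y : MarkedNC p q} (h : x.BasicLE y) :
    x.rank + absLength (x.perm⁻¹ * y.perm) = y.rank := by
  unfold rank
  rcases h with ⟨hm, hle⟩ | ⟨hx, hy, -, -, hle⟩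
  · unfold AbsLE at hle
    rw [hm]
    omega
  · rw [hx, hy]
    simp only [Fin.val_zero, Fin.val_one]
    omega

/-- Between two comparable elements whose ranks differ by more than one there is a third one. -/
theorem BasicLE.exists_between {x y : MarkedNC p q} (h : x.BasicLE y)
    (hgap : x.rank + 2 ≤ y.rank) : ∃ z, x.BasicLE z ∧ z.BasicLE y ∧ z.rank = x.rank + 1 := by
  have hd := h.absLength_eq
  obtain ⟨t, ht, hstep⟩ := exists_swap_step (ρ := x.perm⁻¹ * y.perm) (by omega)
  set τ := x.perm * t with hτ
  have hτy : τ⁻¹ * y.perm = t⁻¹ * (x.perm⁻¹ * y.perm) := by rw [hτ, mul_inv_rev, mul_assoc]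
  have hxτ : x.perm⁻¹ * τ = t := inv_mul_cancel_left _ _
  have ht1 := absLength_eq_one_iff.2 ht
  rw [← hτy] at hstep
  have h1 : absLength τ ≤ absLength x.perm + 1 := ht1 ▸ absLength_mul_le x.perm t
  have h2 := absLength_le_add τ y.perm
  have h3 := absLength_inv_mul_le τ y.perm (alpha p q)
  rcases h with ⟨hm, hle⟩ | ⟨hx, hy, hcx, hcy, hle⟩
  · unfold AbsLE at hle
    have hup : absLength τ = absLength x.perm + 1 := by omega
    have hb1 : AbsLE x.perm τ := by rw [AbsLE, hxτ, ht1, hup]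
    have hb2 : AbsLE τ y.perm := by rw [AbsLE]; omega
    by_cases hyB : y.perm ∈ blockSubgroup (firstBlock p q)
    · have hτB : τ ∈ blockSubgroup (firstBlock p q) := by
        by_contra hn
        have := absLength_add_two_le_of_notMem hyB hn
        omega
      have hα := y.absLength_of_mem hyB
      refine ⟨ofMem τ hτB (by omega) x.mark, Or.inl ⟨rfl, hb1⟩, Or.inl ⟨hm, hb2⟩, ?_⟩
      simp only [rank, ofMem]
      omega
    · have hα := y.absLength_of_notMem hyB
      have hy0 := y.mark_eq_zero_of_notMem hyB
      by_cases hτB : τ ∈ blockSubgroup (firstBlock p q)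
      · have h4 : τ⁻¹ * y.perm ∉ blockSubgroup (firstBlock p q) := fun hn =>
          hyB (by simpa using mul_mem hτB hn)
        have h5 := absLength_add_two_le_of_notMem
          (mul_mem (inv_mem hτB) (alpha_mem_blockSubgroup (p := p) (q := q))) h4
        have h6 : (τ⁻¹ * y.perm)⁻¹ * (τ⁻¹ * alpha p q) = y.perm⁻¹ * alpha p q := by group
        rw [h6] at h5
        refine ⟨ofMem τ hτB (by omega) x.mark, Or.inl ⟨rfl, hb1⟩, Or.inl ⟨hm, hb2⟩, ?_⟩
        simp only [rank, ofMem]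
        omega
      · refine ⟨ofNotMem τ hτB (by omega), Or.inl ⟨hm.trans hy0, hb1⟩, Or.inl ⟨hy0.symm, hb2⟩, ?_⟩
        simp only [rank, ofNotMem, hm.trans hy0]
        simp only [Fin.val_zero]
        omega
  · have hxB := connected_iff.1 hcx
    have hyB : y.perm ∈ blockSubgroup (firstBlock p q) := y.mem_of_mark hy
    have hα := y.absLength_of_mem hyB
    by_cases hτB : τ ∈ blockSubgroup (firstBlock p q)
    · have htB : t ∉ blockSubgroup (firstBlock p q) := fun htB =>
        hxB (by simpa [hτ] using mul_mem hτB (inv_mem htB))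
      have h4 := absLength_mul_cross hτB ht htB
      have h5 : τ * t = x.perm := by rw [hτ, mul_assoc, isSwap_mul_self ht, mul_one]
      rw [h5] at h4
      have hb1 : absLength τ + 2 = absLength x.perm + absLength (x.perm⁻¹ * τ) := by
        rw [hxτ, ht1]
        omega
      have hb2 : AbsLE τ y.perm := by rw [AbsLE]; omega
      refine ⟨ofMem τ hτB (by omega) 1,
        Or.inr ⟨hx, rfl, hcx, fun hc => connected_iff.1 hc hτB, hb1⟩,
        Or.inl ⟨hy.symm, hb2⟩, ?_⟩
      simp only [rank, ofMem, hx]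
      simp only [Fin.val_zero, Fin.val_one]
      omega
    · have h4 := absLength_add_two_le_of_notMem hyB hτB
      have hup : absLength τ = absLength x.perm + 1 := by omega
      have hb1 : AbsLE x.perm τ := by rw [AbsLE, hxτ, ht1, hup]
      refine ⟨ofNotMem τ hτB (by omega), Or.inl ⟨hx, hb1⟩,
        Or.inr ⟨rfl, hy, connected_iff.2 hτB, hcy, ?_⟩, ?_⟩
      · simp only [ofNotMem]
        omega
      · simp only [rank, ofNotMem, hx]
        simp only [Fin.val_zero]
        omega

theorem exists_basicLE_of_lt {x y : MarkedNC p q} (h : x < y) :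
    ∃ z, x.BasicLE z ∧ x ≠ z ∧ z ≤ y := by
  have hle : Relation.ReflTransGen BasicLE x y := h.le
  have hne := h.ne
  clear h
  induction hle using Relation.ReflTransGen.head_induction_on with
  | refl => exact absurd rfl hne
  | @head a c hac hcy ih =>
    rcases eq_or_ne a c with rfl | hne'
    · exact ih hne
    · exact ⟨c, hac, hne', hcy⟩

theorem eq_of_le_of_rank_eq {x y : MarkedNC p q} (h : x ≤ y) (hr : x.rank = y.rank) : x = y := by
  by_contra hne
  exact (rank_lt_of_lt (lt_of_le_of_ne h hne)).ne hr

theorem basicLE_of_lt_of_rank {x y : MarkedNC p q} (h : x < y) (hr : y.rank = x.rank + 1) :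
    x.BasicLE y := by
  obtain ⟨z, hz, hne, hzy⟩ := exists_basicLE_of_lt h
  have h1 := rank_lt_of_lt (lt_of_le_of_ne hz.le hne)
  rcases hzy.lt_or_eq with h2 | rfl
  · have := rank_lt_of_lt h2
    omega
  · exact hz

theorem rank_eq_of_covBy {x y : MarkedNC p q} (h : x ⋖ y) : y.rank = x.rank + 1 := by
  obtain ⟨z, hz, hne, hzy⟩ := exists_basicLE_of_lt h.lt
  obtain rfl : z = y := by
    by_contra hn
    exact h.2 (lt_of_le_of_ne hz.le hne) (lt_of_le_of_ne hzy hn)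
  have h1 := rank_lt_of_lt h.lt
  by_contra hr
  obtain ⟨w, hw1, hw2, hw⟩ := hz.exists_between (by omega)
  refine h.2 (lt_of_le_of_ne hw1.le ?_) (lt_of_le_of_ne hw2.le ?_)
  · rintro rfl
    omega
  · rintro rfl
    omega

theorem covBy_of_rank {x y : MarkedNC p q} (h : x.BasicLE y) (hr : y.rank = x.rank + 1) :
    x ⋖ y := by
  refine ⟨lt_of_le_of_ne h.le ?_, fun z h1 h2 => ?_⟩
  · rintro rfl
    omega
  · have := rank_lt_of_lt h1
    have := rank_lt_of_lt h2
    omega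

/-- The least element. -/
def least (p q : ℕ) : MarkedNC p q :=
  ofMem 1 (one_mem _) (by rw [absLength_one, inv_one, one_mul, zero_add]) 0

/-- The greatest element. -/
def greatest (p q : ℕ) : MarkedNC p q :=
  ofMem (alpha p q) alpha_mem_blockSubgroup
    (by rw [inv_mul_cancel, absLength_one, add_zero]) 1

theorem basicLE_least {x : MarkedNC p q} (h : x.mark = 0) : (least p q).BasicLE x := by
  refine Or.inl ⟨h.symm, ?_⟩
  simp only [least, ofMem, AbsLE, absLength_one, inv_one, one_mul, zero_add]

theorem basicLE_greatest {x : MarkedNC p q} (h : x.mark = 1) : x.BasicLE (greatest p q) :=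
  Or.inl ⟨h, x.absLength_of_mem (x.mem_of_mark h)⟩

theorem exists_cross_swap (hp : 0 < p) (hq : 0 < q) :
    ∃ t : Perm (Fin (p + q)), t.IsSwap ∧ t ∉ blockSubgroup (firstBlock p q) := by
  refine ⟨swap (Fin.castAdd q ⟨0, hp⟩) (Fin.natAdd p ⟨0, hq⟩), ⟨_, _, fun h => ?_, rfl⟩,
    swap_notMem_blockSubgroup _ _⟩
  exact natAdd_notMem (p := p) (⟨0, hq⟩ : Fin q) (h ▸ castAdd_mem _)

theorem least_le (hp : 0 < p) (hq : 0 < q) (x : MarkedNC p q) : least p q ≤ x := by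
  by_cases h : x.mark = 0
  · exact (basicLE_least h).le
  · have hx1 : x.mark = 1 := by omega
    have hxB := x.mem_of_mark hx1
    obtain ⟨t, ht, htB⟩ := exists_cross_swap hp hq
    have ht1 := absLength_eq_one_iff.2 ht
    let z : MarkedNC p q := ofNotMem t htB (by
      rw [isSwap_inv ht, absLength_cross_mul alpha_mem_blockSubgroup ht htB, ht1]
      omega)
    have hz : z.BasicLE x := Or.inr ⟨rfl, hx1, connected_iff.2 htB, x.disconnected_of_mark hx1, by
      change _ = absLength t + absLength (t⁻¹ * x.perm)
      rw [isSwap_inv ht, absLength_cross_mul hxB ht htB, ht1]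
      omega⟩
    exact (basicLE_least (x := z) rfl).le.trans hz.le

theorem le_greatest (hp : 0 < p) (hq : 0 < q) (x : MarkedNC p q) : x ≤ greatest p q := by
  have hconn : ∀ z : MarkedNC p q, z.perm ∉ blockSubgroup (firstBlock p q) →
      z.BasicLE (greatest p q) := fun z hz =>
    Or.inr ⟨z.mark_eq_zero_of_notMem hz, rfl, connected_iff.2 hz,
      (greatest p q).disconnected_of_mark rfl, z.absLength_of_notMem hz⟩
  by_cases h : x.mark = 1
  · exact (basicLE_greatest h).le
  · by_cases hxB : x.perm ∈ blockSubgroup (firstBlock p q)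
    · obtain ⟨t, ht, htB⟩ := exists_cross_swap hp hq
      have ht1 := absLength_eq_one_iff.2 ht
      have h1 := absLength_mul_cross alpha_mem_blockSubgroup ht htB
      have h2 := absLength_mul_cross
        (mul_mem (inv_mem hxB) (alpha_mem_blockSubgroup (p := p) (q := q))) ht htB
      have htα : alpha p q * t ∉ blockSubgroup (firstBlock p q) := fun hn =>
        htB (by simpa using mul_mem (inv_mem alpha_mem_blockSubgroup) hn)
      let z : MarkedNC p q := ofNotMem (alpha p q * t) htα (by
        rw [mul_inv_rev, mul_assoc, inv_mul_cancel, mul_one, absLength_inv, h1, ht1])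
      have hz : x.BasicLE z := Or.inl ⟨by change _ = 0; omega, by
        change absLength (alpha p q * t) = _ + absLength (x.perm⁻¹ * (alpha p q * t))
        rw [← mul_assoc, h1, h2, x.absLength_of_mem hxB, add_assoc]⟩
      exact hz.le.trans (hconn z htα).le
    · exact (hconn x hxB).le

theorem rank_least : (least p q).rank = 0 := by
  simp [rank, least, ofMem, absLength_one]

theorem rank_greatest (hp : 0 < p) (hq : 0 < q) : (greatest p q).rank = p + q := by
  rw [← absLength_alpha hp hq]
  rfl

/-- The bounds of the poset. -/
@[reducible]
def boundedOrder (hp : 0 < p) (hq : 0 < q) : BoundedOrder (MarkedNC p q) where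
  top := greatest p q
  le_top := le_greatest hp hq
  bot := least p q
  bot_le := least_le hp hq

end MarkedNC

end Poset

section Flags

variable {p q : ℕ}

/-- The length of the product of a prefix of a factorization of `alpha p q`, according to whether
some transposition of the remaining suffix exchanges letters of the two blocks. -/
theorem absLength_prefix {l₁ l₂ : List (Perm (Fin (p + q)))} (h₁ : ∀ t ∈ l₁, t.IsSwap)
    (h₂ : ∀ t ∈ l₂, t.IsSwap) (hprod : l₁.prod * l₂.prod = alpha p q)
    (hlen : l₁.length + l₂.length = absLength (alpha p q) + 2)
    (hcross : (∃ t ∈ l₁, t ∉ blockSubgroup (firstBlock p q)) ∨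
      ∃ t ∈ l₂, t ∉ blockSubgroup (firstBlock p q)) :
    ((∃ t ∈ l₂, t ∉ blockSubgroup (firstBlock p q)) ∧ absLength l₁.prod = l₁.length ∧
      (l₁.prod ∈ blockSubgroup (firstBlock p q) → absLength l₂.prod + 2 ≤ l₂.length)) ∨
    ((¬ ∃ t ∈ l₂, t ∉ blockSubgroup (firstBlock p q)) ∧ absLength l₁.prod + 2 = l₁.length ∧
      l₁.prod ∈ blockSubgroup (firstBlock p q)) := by
  have hα : alpha p q ∈ blockSubgroup (firstBlock p q) := alpha_mem_blockSubgroup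
  have e : l₁.prod⁻¹ * alpha p q = l₂.prod := by rw [← hprod, inv_mul_cancel_left]
  have b1 := absLength_le_of_list l₁ h₁ rfl
  have b2 := absLength_le_of_list l₂ h₂ rfl
  have b3 := absLength_le_add l₁.prod (alpha p q)
  rw [e] at b3
  by_cases hc : ∃ t ∈ l₂, t ∉ blockSubgroup (firstBlock p q)
  · refine Or.inl ⟨hc, ?_⟩
    by_cases hB : l₁.prod ∈ blockSubgroup (firstBlock p q)
    · have h2 := absLength_add_two_le l₂ h₂ hc (e ▸ mul_mem (inv_mem hB) hα)
      exact ⟨by omega, fun _ => h2⟩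
    · have h2 := absLength_add_two_le_of_notMem hα hB
      rw [e] at h2
      exact ⟨by omega, fun h => absurd h hB⟩
  · refine Or.inr ⟨hc, ?_⟩
    have hB2 : l₂.prod ∈ blockSubgroup (firstBlock p q) :=
      Subgroup.list_prod_mem _ fun t ht => by
        by_contra hn
        exact hc ⟨t, ht, hn⟩
    have hB : l₁.prod ∈ blockSubgroup (firstBlock p q) := by
      have := mul_mem hα (inv_mem hB2)
      rwa [← hprod, mul_inv_cancel_right] at this
    have h2 := absLength_add_two_le l₁ h₁ (hcross.resolve_right hc) hB
    exact ⟨by omega, hB⟩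

theorem prefix_spec (hp : 0 < p) (hq : 0 < q) {η : Fin (p + q) → Perm (Fin (p + q))}
    (hη : η ∈ crossWords (firstBlock p q) (p + q) (alpha p q)) (i : Fin (p + q + 1)) :
    ((∃ t ∈ (List.ofFn η).drop i, t ∉ blockSubgroup (firstBlock p q)) ∧
      absLength (Fin.partialProd η i) = i ∧
      (Fin.partialProd η i ∈ blockSubgroup (firstBlock p q) →
        absLength ((Fin.partialProd η i)⁻¹ * alpha p q) + 2 ≤ p + q - i)) ∨
    ((¬ ∃ t ∈ (List.ofFn η).drop i, t ∉ blockSubgroup (firstBlock p q)) ∧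
      absLength (Fin.partialProd η i) + 2 = i ∧
      Fin.partialProd η i ∈ blockSubgroup (firstBlock p q)) := by
  obtain ⟨⟨hs, hprod⟩, k, hk⟩ := hη
  have hs' : ∀ t ∈ List.ofFn η, t.IsSwap := List.forall_mem_ofFn_iff.2 hs
  have hi : (i : ℕ) ≤ p + q := Nat.lt_succ_iff.1 i.isLt
  have hmul : ((List.ofFn η).take i).prod * ((List.ofFn η).drop i).prod = alpha p q := by
    rw [List.prod_take_mul_prod_drop, hprod]
  have e : ((List.ofFn η).take i).prod⁻¹ * alpha p q = ((List.ofFn η).drop i).prod := by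
    rw [← hmul, inv_mul_cancel_left]
  have := absLength_prefix (l₁ := (List.ofFn η).take i) (l₂ := (List.ofFn η).drop i)
    (fun t ht => hs' t (List.mem_of_mem_take ht)) (fun t ht => hs' t (List.mem_of_mem_drop ht))
    hmul (by rw [← List.length_append, List.take_append_drop, List.length_ofFn,
      absLength_alpha hp hq]) (by
      have hmem : η k ∈ (List.ofFn η).take i ++ (List.ofFn η).drop i := by
        rw [List.take_append_drop]
        exact List.mem_ofFn.2 ⟨k, rfl⟩
      exact (List.mem_append.1 hmem).imp (fun h => ⟨_, h, hk⟩) fun h => ⟨_, h, hk⟩)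
  rw [← e, List.length_take, List.length_drop, List.length_ofFn, min_eq_left hi] at this
  exact this

theorem absLength_partialProd_inv_mul_le {η : Fin (p + q) → Perm (Fin (p + q))}
    (hη : η ∈ crossWords (firstBlock p q) (p + q) (alpha p q)) (i : Fin (p + q + 1)) :
    absLength ((Fin.partialProd η i)⁻¹ * alpha p q) ≤ p + q - i := by
  obtain ⟨⟨hs, hprod⟩, -⟩ := hη
  have hs' : ∀ t ∈ List.ofFn η, t.IsSwap := List.forall_mem_ofFn_iff.2 hs
  have e : (Fin.partialProd η i)⁻¹ * alpha p q = ((List.ofFn η).drop i).prod := by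
    rw [← hprod, ← List.prod_take_mul_prod_drop (List.ofFn η) i]
    exact inv_mul_cancel_left _ _
  rw [e]
  have := absLength_le_of_list ((List.ofFn η).drop i)
    (fun t ht => hs' t (List.mem_of_mem_drop ht)) rfl
  rwa [List.length_drop, List.length_ofFn] at this

open scoped Classical in
/-- The element of the poset given by a prefix of a factorization. -/
noncomputable def prefixElem (hp : 0 < p) (hq : 0 < q) {η : Fin (p + q) → Perm (Fin (p + q))}
    (hη : η ∈ crossWords (firstBlock p q) (p + q) (alpha p q)) (i : Fin (p + q + 1)) :
    MarkedNC p q where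
  perm := Fin.partialProd η i
  mark := if ∃ t ∈ (List.ofFn η).drop i, t ∉ blockSubgroup (firstBlock p q) then 0 else 1
  le_of_disconnected hc := by
    have hB := not_not.1 fun h => hc (connected_iff.2 h)
    have h1 := absLength_le_add (Fin.partialProd η i) (alpha p q)
    have h2 := absLength_alpha hp hq
    have h3 := absLength_partialProd_inv_mul_le hη i
    have hi := i.isLt
    rw [AbsLE]
    rcases prefix_spec hp hq hη i with ⟨-, h4, h5⟩ | ⟨-, h4, -⟩
    · have := h5 hB
      omega
    · omega
  length_of_connected hc := by
    have hB := connected_iff.1 hc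
    have h1 := absLength_add_two_le_of_notMem alpha_mem_blockSubgroup hB
    have h2 := absLength_alpha hp hq
    have h3 := absLength_partialProd_inv_mul_le hη i
    have hi := i.isLt
    rcases prefix_spec hp hq hη i with ⟨-, h4, -⟩ | ⟨-, -, h5⟩
    · omega
    · exact absurd h5 hB
  disconnected_of_mark h1 hc := by
    rcases prefix_spec hp hq hη i with ⟨h, -⟩ | ⟨-, -, h5⟩
    · rw [if_pos h] at h1
      exact absurd h1 (by decide)
    · exact connected_iff.1 hc h5

theorem rank_prefixElem (hp : 0 < p) (hq : 0 < q) {η : Fin (p + q) → Perm (Fin (p + q))}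
    (hη : η ∈ crossWords (firstBlock p q) (p + q) (alpha p q)) (i : Fin (p + q + 1)) :
    (prefixElem hp hq hη i).rank = i := by
  rcases prefix_spec hp hq hη i with ⟨h, h4, -⟩ | ⟨h, h4, -⟩
  · simp only [MarkedNC.rank, prefixElem, if_pos h]
    simpa using h4
  · simp only [MarkedNC.rank, prefixElem, if_neg h]
    simpa using h4

theorem drop_castSucc {η : Fin (p + q) → Perm (Fin (p + q))} (i : Fin (p + q)) :
    (List.ofFn η).drop i.castSucc = η i :: (List.ofFn η).drop i.succ := by
  rw [Fin.val_castSucc, Fin.val_succ, List.drop_eq_getElem_cons (by simp)]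
  simp

theorem prefixElem_basicLE (hp : 0 < p) (hq : 0 < q) {η : Fin (p + q) → Perm (Fin (p + q))}
    (hη : η ∈ crossWords (firstBlock p q) (p + q) (alpha p q)) (i : Fin (p + q)) :
    (prefixElem hp hq hη i.castSucc).BasicLE (prefixElem hp hq hη i.succ) := by
  have hstep : (Fin.partialProd η i.castSucc)⁻¹ * Fin.partialProd η i.succ = η i :=
    Fin.partialProd_right_inv η i
  have ht := absLength_eq_one_iff.2 (hη.1.1 i)
  have hdrop := drop_castSucc (η := η) i
  have hcs := i.val_castSucc
  have hsu := i.val_succ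
  rcases prefix_spec hp hq hη i.castSucc with ⟨h, h4, -⟩ | ⟨h, h4, -⟩ <;>
  rcases prefix_spec hp hq hη i.succ with ⟨h', h4', -⟩ | ⟨h', h4', h5'⟩
  · refine Or.inl ⟨by simp only [prefixElem, if_pos h, if_pos h'], ?_⟩
    simp only [AbsLE, prefixElem, hstep]
    omega
  · have hiB : η i ∉ blockSubgroup (firstBlock p q) := by
      rw [hdrop] at h
      obtain ⟨t, ht, htB⟩ := h
      rcases List.mem_cons.1 ht with rfl | ht
      · exact htB
      · exact absurd ⟨t, ht, htB⟩ h'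
    refine Or.inr ⟨by simp only [prefixElem, if_pos h], by simp only [prefixElem, if_neg h'],
      connected_iff.2 fun hB => ?_, fun hc => connected_iff.1 hc h5', ?_⟩
    · exact hiB (hstep ▸ mul_mem (inv_mem hB) h5')
    · simp only [prefixElem, hstep]
      omega
  · obtain ⟨t, ht, htB⟩ := h'
    exact absurd ⟨t, hdrop ▸ List.mem_cons_of_mem _ ht, htB⟩ h
  · refine Or.inl ⟨by simp only [prefixElem, if_neg h, if_neg h'], ?_⟩
    simp only [AbsLE, prefixElem, hstep]
    omega

theorem MarkedNC.eq_of_perm_eq_of_rank_eq {x y : MarkedNC p q} (h1 : x.perm = y.perm)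
    (h2 : x.rank = y.rank) : x = y := by
  refine MarkedNC.ext h1 (Fin.ext ?_)
  unfold MarkedNC.rank at h2
  rw [h1] at h2
  omega

theorem prefixElem_zero (hp : 0 < p) (hq : 0 < q) {η : Fin (p + q) → Perm (Fin (p + q))}
    (hη : η ∈ crossWords (firstBlock p q) (p + q) (alpha p q)) :
    prefixElem hp hq hη 0 = MarkedNC.least p q :=
  MarkedNC.eq_of_perm_eq_of_rank_eq (Fin.partialProd_zero η)
    (by rw [rank_prefixElem, MarkedNC.rank_least, Fin.val_zero])

theorem partialProd_last {n : ℕ} {M : Type*} [Monoid M] (η : Fin n → M) :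
    Fin.partialProd η (Fin.last n) = (List.ofFn η).prod := by
  rw [Fin.partialProd, Fin.val_last, List.take_of_length_le (by simp)]

theorem prefixElem_last (hp : 0 < p) (hq : 0 < q) {η : Fin (p + q) → Perm (Fin (p + q))}
    (hη : η ∈ crossWords (firstBlock p q) (p + q) (alpha p q)) :
    prefixElem hp hq hη (Fin.last _) = MarkedNC.greatest p q :=
  MarkedNC.eq_of_perm_eq_of_rank_eq ((partialProd_last η).trans hη.1.2)
    (by rw [rank_prefixElem, MarkedNC.rank_greatest hp hq, Fin.val_last])

theorem prefixElem_covBy (hp : 0 < p) (hq : 0 < q) {η : Fin (p + q) → Perm (Fin (p + q))}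
    (hη : η ∈ crossWords (firstBlock p q) (p + q) (alpha p q)) (i : Fin (p + q)) :
    prefixElem hp hq hη i.castSucc ⋖ prefixElem hp hq hη i.succ :=
  MarkedNC.covBy_of_rank (prefixElem_basicLE hp hq hη i) (by
    rw [rank_prefixElem, rank_prefixElem, Fin.val_succ, Fin.val_castSucc])

/-- The maximal chain of the prefixes of a factorization. -/
noncomputable def wordFlag (hp : 0 < p) (hq : 0 < q)
    (η : crossWords (firstBlock p q) (p + q) (alpha p q)) : Flag (MarkedNC p q) :=
  letI := MarkedNC.boundedOrder hp hq
  Flag.rangeFin (prefixElem hp hq η.2) (prefixElem_zero hp hq η.2) (prefixElem_last hp hq η.2)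
    fun i => (prefixElem_covBy hp hq η.2 i).wcovBy

theorem mem_wordFlag (hp : 0 < p) (hq : 0 < q)
    (η : crossWords (firstBlock p q) (p + q) (alpha p q)) (x : MarkedNC p q) :
    x ∈ wordFlag hp hq η ↔ ∃ i, prefixElem hp hq η.2 i = x :=
  letI := MarkedNC.boundedOrder hp hq
  Flag.mem_rangeFin

theorem flag_lt_of_rank_lt (C : Flag (MarkedNC p q)) {x y : MarkedNC p q} (hx : x ∈ C) (hy : y ∈ C)
    (h : x.rank < y.rank) : x < y := by
  rcases C.le_or_le hx hy with h1 | h1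
  · refine lt_of_le_of_ne h1 ?_
    rintro rfl
    exact h.false
  · rcases MarkedNC.rank_lt_or_eq_of_reflTransGen h1 with h2 | rfl
    · omega
    · exact absurd h (lt_irrefl _)

theorem flag_eq_of_rank_eq (C : Flag (MarkedNC p q)) {x y : MarkedNC p q} (hx : x ∈ C) (hy : y ∈ C)
    (h : x.rank = y.rank) : x = y := by
  rcases C.le_or_le hx hy with h1 | h1
  · exact MarkedNC.eq_of_le_of_rank_eq h1 h
  · exact (MarkedNC.eq_of_le_of_rank_eq h1 h.symm).symm

theorem least_mem_flag (hp : 0 < p) (hq : 0 < q) (C : Flag (MarkedNC p q)) :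
    MarkedNC.least p q ∈ C :=
  letI := MarkedNC.boundedOrder hp hq
  C.bot_mem

theorem greatest_mem_flag (hp : 0 < p) (hq : 0 < q) (C : Flag (MarkedNC p q)) :
    MarkedNC.greatest p q ∈ C :=
  letI := MarkedNC.boundedOrder hp hq
  C.top_mem

theorem exists_mem_flag_rank (hp : 0 < p) (hq : 0 < q) (C : Flag (MarkedNC p q)) (r : ℕ)
    (hr : r ≤ p + q) : ∃ x ∈ C, x.rank = r := by
  induction r with
  | zero => exact ⟨_, least_mem_flag hp hq C, MarkedNC.rank_least⟩
  | succ r ih =>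
    obtain ⟨x, hx, hxr⟩ := ih (by omega)
    have htop := greatest_mem_flag hp hq C
    have hlt : x < MarkedNC.greatest p q :=
      flag_lt_of_rank_lt C hx htop (by rw [MarkedNC.rank_greatest hp hq]; omega)
    obtain ⟨y, ⟨hy, hxy⟩, hmin⟩ := exists_minimalFor_of_wellFoundedLT
      (fun y => y ∈ C ∧ x < y) MarkedNC.rank ⟨_, htop, hlt⟩
    refine ⟨y, hy, ?_⟩
    rw [MarkedNC.rank_eq_of_covBy (x := x) (y := y) ⟨hxy, fun z hxz hzy => ?_⟩, hxr]
    have hzC : z ∈ C := by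
      rw [Flag.mem_iff_forall_le_or_ge]
      intro w hw
      rcases lt_or_ge x.rank w.rank with h | h
      · left
        have hxw := flag_lt_of_rank_lt C hx hw h
        rcases C.le_or_le hy hw with h1 | h1
        · exact hzy.le.trans h1
        · rcases h1.lt_or_eq with h2 | rfl
          · have h3 := hmin ⟨hw, hxw⟩ (MarkedNC.rank_lt_of_lt h2).le
            have h4 := MarkedNC.rank_lt_of_lt h2
            omega
          · exact hzy.le
      · right
        rcases C.le_or_le hx hw with h1 | h1
        · rcases h1.lt_or_eq with h2 | rfl
          · have := MarkedNC.rank_lt_of_lt h2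
            omega
          · exact hxz.le
        · exact h1.trans hxz.le
    have h3 := hmin ⟨hzC, hxz⟩ (MarkedNC.rank_lt_of_lt hzy).le
    have h4 := MarkedNC.rank_lt_of_lt hzy
    omega

theorem wordFlag_injective (hp : 0 < p) (hq : 0 < q) :
    Function.Injective (wordFlag (p := p) (q := q) hp hq) := by
  intro η η' h
  have key : ∀ i, prefixElem hp hq η.2 i = prefixElem hp hq η'.2 i := by
    intro i
    refine flag_eq_of_rank_eq (wordFlag hp hq η) ((mem_wordFlag _ _ _ _).2 ⟨i, rfl⟩) ?_ ?_
    · rw [h]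
      exact (mem_wordFlag _ _ _ _).2 ⟨i, rfl⟩
    · rw [rank_prefixElem, rank_prefixElem]
  have key' : ∀ i, Fin.partialProd η.1 i = Fin.partialProd η'.1 i := fun i =>
    congrArg MarkedNC.perm (key i)
  refine Subtype.ext (funext fun i => ?_)
  rw [← Fin.partialProd_right_inv η.1 i, ← Fin.partialProd_right_inv η'.1 i, key', key']

theorem wordFlag_surjective (hp : 0 < p) (hq : 0 < q) :
    Function.Surjective (wordFlag (p := p) (q := q) hp hq) := by
  intro C
  have hex : ∀ i : Fin (p + q + 1), ∃ x ∈ C, x.rank = i := fun i =>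
    exists_mem_flag_rank hp hq C i (Nat.lt_succ_iff.1 i.isLt)
  choose x hxC hxr using hex
  have hx0 : x 0 = MarkedNC.least p q :=
    flag_eq_of_rank_eq C (hxC 0) (least_mem_flag hp hq C) (by
      rw [hxr, MarkedNC.rank_least, Fin.val_zero])
  have hxl : x (Fin.last _) = MarkedNC.greatest p q :=
    flag_eq_of_rank_eq C (hxC _) (greatest_mem_flag hp hq C) (by
      rw [hxr, MarkedNC.rank_greatest hp hq, Fin.val_last])
  have hbasic : ∀ i : Fin (p + q), (x i.castSucc).BasicLE (x i.succ) := fun i => by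
    have hr : (x i.succ).rank = (x i.castSucc).rank + 1 := by
      rw [hxr, hxr, Fin.val_succ, Fin.val_castSucc]
    exact MarkedNC.basicLE_of_lt_of_rank
      (flag_lt_of_rank_lt C (hxC _) (hxC _) (by omega)) hr
  let η : Fin (p + q) → Perm (Fin (p + q)) := fun i => (x i.castSucc).perm⁻¹ * (x i.succ).perm
  have hpart : ∀ i, Fin.partialProd η i = (x i).perm := by
    intro i
    induction i using Fin.induction with
    | zero => rw [Fin.partialProd_zero, hx0]; rfl
    | succ i ih => rw [Fin.partialProd_succ, ih, mul_inv_cancel_left]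
  have hη : η ∈ crossWords (firstBlock p q) (p + q) (alpha p q) := by
    refine ⟨⟨fun i => ?_, ?_⟩, ?_⟩
    · have := (hbasic i).absLength_eq
      rw [hxr, hxr, Fin.val_succ, Fin.val_castSucc] at this
      exact absLength_eq_one_iff.1 (by simp only [η]; omega)
    · rw [← partialProd_last, hpart, hxl]
      rfl
    · by_contra! hno
      have hmark : ∀ i, (x i).mark = 0 ∧ (x i).perm ∈ blockSubgroup (firstBlock p q) := by
        intro i
        induction i using Fin.induction with
        | zero => rw [hx0]; exact ⟨rfl, one_mem _⟩
        | succ i ih =>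
          have hmem : (x i.succ).perm ∈ blockSubgroup (firstBlock p q) := by
            have := mul_mem ih.2 (hno i)
            rwa [mul_inv_cancel_left] at this
          refine ⟨?_, hmem⟩
          rcases hbasic i with ⟨h, -⟩ | ⟨-, -, hc, -⟩
          · rw [← h, ih.1]
          · exact absurd ih.2 (connected_iff.1 hc)
      have := (hmark (Fin.last _)).1
      rw [hxl] at this
      exact absurd (show (1 : Fin 2) = 0 from this) (by decide)
  refine ⟨⟨η, hη⟩, Flag.ext ?_⟩
  refine (wordFlag hp hq ⟨η, hη⟩).maxChain.2 C.chain_le fun y hy => ?_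
  obtain ⟨i, rfl⟩ := (mem_wordFlag _ _ _ _).1 hy
  have : prefixElem hp hq hη i = x i :=
    MarkedNC.eq_of_perm_eq_of_rank_eq (hpart i) (by rw [rank_prefixElem, hxr])
  change prefixElem hp hq hη i ∈ C
  rw [this]
  exact hxC i

theorem card_flag (hp : 0 < p) (hq : 0 < q) :
    Nat.card (Flag (MarkedNC p q)) =
      Nat.card (crossWords (firstBlock p q) (p + q) (alpha p q)) :=
  (Nat.card_congr (Equiv.ofBijective _
    ⟨wordFlag_injective hp hq, wordFlag_surjective hp hq⟩)).symm

end Flags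

end AnnularNC

theorem mainTheorem7 (p q : ℕ) (hp : 0 < p) (hq : 0 < q) :
    -- `Flag P` is the type of maximal chains of the poset `P`; the terms with `c > p` vanish
    Nat.card (Flag (AnnularNC.MarkedNC p q)) =
        ∑ c ∈ Finset.Icc 1 p, c * (p + q).choose (p - c) * p ^ (p - c) * q ^ (q + c) ∧
      (Nat.card (AnnularNC.MinTransFact p q) : ℚ) =
        (p * q : ℚ) / (p + q) * (p + q).choose q * (p : ℚ) ^ p * (q : ℚ) ^ q := by
  have h := AnnularNC.card_crossWords_alpha hp hq
  constructor
  · rw [AnnularNC.card_flag hp hq]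
    rw [← AnnularNC.sum_choose_eq_closed p q hp hq] at h
    exact_mod_cast h
  · rw [AnnularNC.minTransFact_eq hp hq]
    rw [← (Rat.cast_injective (α := ℝ)).eq_iff]
    push_cast
    exact h
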